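/- **Setting.** Let $\mathcal Z$ be a measurable space, $\mathcal D$ a probability distribution on it, and $S=(Z_1,\dots,Z_n)$, $S'=(Z_1',\dots,Z_n')$ ($n\ge1$) two samples with i.i.d. entries of law $\mathcal D$. Let $\ell:\mathbb R^d\times\mathcal Z\to\mathbb R$ be measurable and differentiable in $w$, and put $g(w,z)=\nabla_w\ell(w,z)$, $\bar g(w)=\mathbb E_{Z\sim\mathcal D}\,g(w,Z)$ (assumed to exist for every $w$) and $L(w,s)=\frac1n\sum_{i=1}^n\ell(w,z_i)$. Assume that for every $w$ the variable $\ell(w,Z)$, $Z\sim\mathcal D$, is $R$-sub-Gaussian: $\mathbb E\,e^{\lambda(\ell(w,Z)-\mathbb E\ell(w,Z))}\le e^{\lambda^2R^2/2}$ for all $\lambda\in\mathbb R$. Write $\|x\|_M^2=x^\top Mx$. *SGD.* Let $T\ge1$, let $W_1$ be a random vector, $\mathcal U$ a sigma-field of auxiliary randomness with $\sigma(W_1)\vee\mathcal U$ independent of $S$, and let $\eta_t>0$ be deterministic. For $t=1,\dots,T-1$ let $J_t$ be a random nonempty minibatch of indices from $\{1,\dots,n\}$ (possibly with repetitions) and $$G_t=\frac1{|J_t|}\sum_{i\in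 J_t}g(W_t,Z_i),\qquad W_{t+1}=W_t-\eta_tG_t .$$ Let $\mathcal H_r=\sigma\big(W_1,\dots,W_{r+1},\,J_1,\dots,J_r,\,(Z_i)_{i\in J_1},\dots,(Z_i)_{i\in J_r},\,G_1,\dots,G_r\big)$. The ghost sample $S'$ is independent of $\mathcal H_{T-1}\vee\sigma(S)$. *Virtual path.* Let $\Sigma_1,\dots,\Sigma_{T-1}$ be random matrices, $\Sigma_t$ being $\mathcal H_{t-1}$-measurable and almost surely positive definite. Conditionally on $\mathcal H_{T-1}\vee\sigma(S)\vee\mathcal U$ let the vectors $\varepsilon_1,\dots,\varepsilon_{T-1}$ be independent with $\varepsilon_t\sim\mathcal N(0,\Sigma_t)$. Put $\widetilde W_1=W_1$, $\widetilde W_{t+1}=\widetilde W_t-\eta_tG_t+\varepsilon_t$, $\xi_t=\widetilde W_t-W_t$ and $\Sigma_{1:T}=\sum_{t=1}^{T-1}\Sigma_t$. *Reference covariances.* For each $t$ let $\Sigma_t^{\mathrm{ref}}$ be an almost surely positive definite random matrix, measurable with respect to $\sigma(\widetilde W_1,\dots,\widetilde W_t)\vee\mathcal U$. *Quantities.* For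 $t=1,\dots,T-1$ let $$V_t^{\mathrm{ad}}=\mathbb E\big[\|G_t-\bar g(W_t)\|^2_{\Sigma_t^{-1}}\,\big|\,\mathcal H_{t-1}\vee\mathcal U\big],\qquad \Gamma_t^{\mathrm{ad}}=\mathbb E\big[\|\bar g(W_t+\xi_t)-\bar g(W_t)\|^2_{\Sigma_t^{-1}}\,\big|\,\mathcal H_{t-1}\vee\mathcal U\big],$$ $$\mathcal C_t^{\mathrm{cov}}=\tfrac12\,\mathbb E\Big[\operatorname{Tr}\big((\Sigma_t^{\mathrm{ref}})^{-1}\Sigma_t\big)-d+\log\frac{\det\Sigma_t^{\mathrm{ref}}}{\det\Sigma_t}\Big],$$ and, for a fixed sample $s$, with $\zeta_T$ a fresh perturbation, $\zeta_T\mid\mathcal H_{T-1}\sim\mathcal N(0,\Sigma_{1:T})$, $$\Delta(W_T,s)=\mathbb E\big[L(W_T,s)-L(W_T+\zeta_T,s)\,\big|\,\mathcal H_{T-1}\big],\qquad \mathcal R_\Delta^{\mathrm{ad}}=\big|\mathbb E[\Delta(W_T,S')-\Delta(W_T,S)]\big| .$$ Let $\mathrm{gen}(W_T,S)=\mathbb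 E[L(W_T,S')-L(W_T,S)]$. Assume that all these quantities are well defined and finite, that is: the integrands of the unconditional expectations $\mathbb E V_t^{\mathrm{ad}}$, $\mathbb E\Gamma_t^{\mathrm{ad}}$, $\mathcal C_t^{\mathrm{cov}}$, $\mathrm{gen}(W_T,S)$ and $\mathbb E[\Delta(W_T,S')-\Delta(W_T,S)]$ are integrable, and almost surely the Gaussian averages over $\zeta_T$ that define $\Delta(W_T,S)$ and $\Delta(W_T,S')$ converge absolutely. **Corollary (comparable covariance geometries).** If there is a $\kappa\ge1$ such that, for all $t=1,\dots,T-1$, $(\Sigma_t^{\mathrm{ref}})^{-1}\preceq\kappa\,\Sigma_t^{-1}$ almost surely, then $$|\mathrm{gen}(W_T,S)|\le\sqrt{\frac{2R^2}{n}\Big[2\kappa\sum_{t=1}^{T-1}\eta_t^2\,\mathbb E\big[V_t^{\mathrm{ad}}+\Gamma_t^{\mathrm{ad}}\big]+\sum_{t=1}^{T-1}\mathcal C_t^{\mathrm{cov}}\Big]}+\mathcal R_\Delta^{\mathrm{ad}} .$$ -/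

import Mathlib

open MeasureTheory ProbabilityTheory
open scoped NNReal

noncomputable section

namespace VirtualSGD

/-- The parameter space `ℝ^d` with its Euclidean norm. -/
abbrev Param (d : ℕ) : Type := EuclideanSpace ℝ (Fin d)

/-- The weighted square norm `‖x‖²_M = xᵀ M x`. -/
def sqNorm {d : ℕ} (M : Matrix (Fin d) (Fin d) ℝ) (x : Param d) : ℝ :=
  WithLp.ofLp x ⬝ᵥ M.mulVec (WithLp.ofLp x)

section Loss

variable {Z : Type*} {d n : ℕ}

/-- The empirical risk `L(w, s) = (1/n) ∑ᵢ ℓ(w, zᵢ)`. -/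
def empRisk (ℓ : Param d → Z → ℝ) (w : Param d) (s : Fin n → Z) : ℝ :=
  (1 / (n : ℝ)) * ∑ i, ℓ w (s i)

/-- The sample gradient `g(w, z) = ∇_w ℓ(w, z)`. -/
def sampleGrad (ℓ : Param d → Z → ℝ) (w : Param d) (z : Z) : Param d :=
  gradient (fun v => ℓ v z) w

/-- The population gradient `ḡ(w) = 𝔼_{Z ∼ D} g(w, Z)`. -/
def popGrad [MeasurableSpace Z] (D : Measure Z) (ℓ : Param d → Z → ℝ) (w : Param d) : Param d :=
  ∫ z, sampleGrad ℓ w z ∂D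

/-- The minibatch gradient `(1/|B|) ∑_{i ∈ B} g(w, zᵢ)`. A minibatch is a multiset of indices, so
that subsets and batches drawn with replacement are both covered. -/
def batchGrad (ℓ : Param d → Z → ℝ) (w : Param d) (s : Fin n → Z) (B : Multiset (Fin n)) :
    Param d :=
  (1 / (B.card : ℝ)) • (B.map fun i => sampleGrad ℓ w (s i)).sum

end Loss

section Dynamics

/-! Updates are numbered `k = 0, 1, …`, so that `sgd … k` is the iterate `W_{k+1}` and
`J k`, `η k`, `ε k`, `Sg k` are the `(k+1)`-st minibatch, learning rate, perturbation and
covariance. With `N` updates the output is `sgd … N`. -/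

variable {Ω Z : Type*} {d n : ℕ}

/-- The SGD iterates. -/
def sgd (ℓ : Param d → Z → ℝ) (η : ℕ → ℝ) (J : ℕ → Ω → Multiset (Fin n)) (W₁ : Ω → Param d)
    (S : Ω → Fin n → Z) : ℕ → Ω → Param d
  | 0, ω => W₁ ω
  | k + 1, ω =>
      sgd ℓ η J W₁ S k ω - η k • batchGrad ℓ (sgd ℓ η J W₁ S k ω) (S ω) (J k ω)

/-- The stochastic gradient along the true trajectory. -/
def stochGrad (ℓ : Param d → Z → ℝ) (η : ℕ → ℝ) (J : ℕ → Ω → Multiset (Fin n))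
    (W₁ : Ω → Param d) (S : Ω → Fin n → Z) (k : ℕ) (ω : Ω) : Param d :=
  batchGrad ℓ (sgd ℓ η J W₁ S k ω) (S ω) (J k ω)

/-- The virtual path: the stochastic gradients are those of the true trajectory. -/
def virtualPath (ℓ : Param d → Z → ℝ) (η : ℕ → ℝ) (J : ℕ → Ω → Multiset (Fin n))
    (W₁ : Ω → Param d) (S : Ω → Fin n → Z) (ε : ℕ → Ω → Param d) : ℕ → Ω → Param d
  | 0, ω => W₁ ω
  | k + 1, ω =>
      virtualPath ℓ η J W₁ S ε k ω - η k • stochGrad ℓ η J W₁ S k ω + ε k ω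

/-- The accumulated virtual perturbation `ξ = W̃ - W`. -/
def accNoise (ℓ : Param d → Z → ℝ) (η : ℕ → ℝ) (J : ℕ → Ω → Multiset (Fin n))
    (W₁ : Ω → Param d) (S : Ω → Fin n → Z) (ε : ℕ → Ω → Param d) (k : ℕ) (ω : Ω) : Param d :=
  virtualPath ℓ η J W₁ S ε k ω - sgd ℓ η J W₁ S k ω

/-- The accumulated covariance before update `k`. -/
def accCov (Sg : ℕ → Ω → Matrix (Fin d) (Fin d) ℝ) (k : ℕ) (ω : Ω) : Matrix (Fin d) (Fin d) ℝ :=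
  ∑ j ∈ Finset.range k, Sg j ω

/-- The data revealed by the `k`-th minibatch: the point `Zᵢ` if `i` is in the batch, and a dummy
value otherwise. -/
def batchData (J : ℕ → Ω → Multiset (Fin n)) (S : Ω → Fin n → Z) (k : ℕ) (ω : Ω) :
    Fin n → Z ⊕ Unit :=
  fun i => if i ∈ J k ω then Sum.inl (S ω i) else Sum.inr ()

/-- The real SGD history after `r` updates: the sigma-field generated by the iterates up to then,
and by the index sets, minibatches and stochastic gradients of the first `r` updates. -/
@[reducible] def history [MeasurableSpace Z] (ℓ : Param d → Z → ℝ) (η : ℕ → ℝ)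
    (J : ℕ → Ω → Multiset (Fin n)) (W₁ : Ω → Param d) (S : Ω → Fin n → Z) (r : ℕ) :
    MeasurableSpace Ω :=
  (⨆ k ∈ Finset.range (r + 1), MeasurableSpace.comap (sgd ℓ η J W₁ S k) inferInstance) ⊔
    ⨆ k ∈ Finset.range r,
      (MeasurableSpace.comap (J k) ⊤ ⊔ MeasurableSpace.comap (batchData J S k) inferInstance ⊔
        MeasurableSpace.comap (stochGrad ℓ η J W₁ S k) inferInstance)

/-- The reference-visible sigma-field: the virtual prefix and the auxiliary randomness `U`. -/
@[reducible] def refVisible (U : MeasurableSpace Ω) (ℓ : Param d → Z → ℝ) (η : ℕ → ℝ)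
    (J : ℕ → Ω → Multiset (Fin n)) (W₁ : Ω → Param d) (S : Ω → Fin n → Z)
    (ε : ℕ → Ω → Param d) (k : ℕ) : MeasurableSpace Ω :=
  (⨆ j ∈ Finset.range (k + 1), MeasurableSpace.comap (virtualPath ℓ η J W₁ S ε j) inferInstance) ⊔ U

end Dynamics

section Probability

variable {Ω Z : Type*} {d n : ℕ}

/-- Entrywise measurability of a random matrix with respect to the sigma-field `m`. -/
def MatrixMeasurable (m : MeasurableSpace Ω) (C : Ω → Matrix (Fin d) (Fin d) ℝ) : Prop :=
  ∀ i j, Measurable[m] fun ω => C ω i j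

/-- `N(0, C ω)` is a regular version of the conditional law of `X` given the sigma-field `m`. -/
def HasCondGaussianLaw (m : MeasurableSpace Ω) [MeasurableSpace Ω] (P : Measure Ω)
    (X : Ω → Param d) (C : Ω → Matrix (Fin d) (Fin d) ℝ) : Prop :=
  ∀ A : Set (Param d), MeasurableSet A →
    P[(X ⁻¹' A).indicator (fun _ => (1 : ℝ)) | m]
      =ᵐ[P] fun ω => (multivariateGaussian 0 (C ω)).real A

/-- A predictable covariance process for `N` updates, relative to the histories `H k`. -/
structure IsPredictableCov [MeasurableSpace Ω] (P : Measure Ω) (H : ℕ → MeasurableSpace Ω)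
    (N : ℕ) (Sg : ℕ → Ω → Matrix (Fin d) (Fin d) ℝ) : Prop where
  measurable : ∀ k < N, MatrixMeasurable (H k) (Sg k)
  posDef : ∀ k < N, ∀ᵐ ω ∂P, (Sg k ω).PosDef

/-- An admissible reference covariance: almost surely positive definite, and measurable with respect
to the reference-visible sigma-field `F`. -/
structure IsAdmissibleRef [MeasurableSpace Ω] (P : Measure Ω) (F : MeasurableSpace Ω)
    (C : Ω → Matrix (Fin d) (Fin d) ℝ) : Prop where
  measurable : MatrixMeasurable F C
  posDef : ∀ᵐ ω ∂P, (C ω).PosDef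

/-- The virtual perturbations: given the whole real history, the sample, the auxiliary randomness
and the earlier perturbations, `ε k` is Gaussian with mean `0` and covariance `Sg k`. Equivalently,
given the whole real history, the sample and the auxiliary randomness, the perturbations are
independent centred Gaussian vectors with covariances `Sg k`. -/
def IsVirtualNoise [MeasurableSpace Z] (U : MeasurableSpace Ω) [MeasurableSpace Ω]
    (P : Measure Ω) (ℓ : Param d → Z → ℝ) (η : ℕ → ℝ) (J : ℕ → Ω → Multiset (Fin n))
    (W₁ : Ω → Param d) (S : Ω → Fin n → Z) (N : ℕ) (Sg : ℕ → Ω → Matrix (Fin d) (Fin d) ℝ)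
    (ε : ℕ → Ω → Param d) : Prop :=
  ∀ k < N, HasCondGaussianLaw
    (history ℓ η J W₁ S N ⊔ MeasurableSpace.comap S inferInstance ⊔ U ⊔
      ⨆ j ∈ Finset.range k, MeasurableSpace.comap (ε j) inferInstance)
    P (ε k) (Sg k)

/-- The expected generalization error `𝔼[L(W, S') - L(W, S)]`. -/
def genError [MeasurableSpace Ω] (P : Measure Ω) (ℓ : Param d → Z → ℝ) (W : Ω → Param d)
    (S S' : Ω → Fin n → Z) : ℝ :=
  ∫ ω, (empRisk ℓ (W ω) (S' ω) - empRisk ℓ (W ω) (S ω)) ∂P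

/-- The gradient-deviation term `V(Λ) = 𝔼[‖G - ḡ(W)‖²_Λ | H ∨ U]` of update `k`. -/
def gradDeviation [MeasurableSpace Z] (U : MeasurableSpace Ω) [MeasurableSpace Ω]
    (P : Measure Ω) (D : Measure Z) (ℓ : Param d → Z → ℝ) (η : ℕ → ℝ)
    (J : ℕ → Ω → Multiset (Fin n)) (W₁ : Ω → Param d) (S : Ω → Fin n → Z)
    (Λ : Ω → Matrix (Fin d) (Fin d) ℝ) (k : ℕ) : Ω → ℝ :=
  P[fun ω => sqNorm (Λ ω)
      (stochGrad ℓ η J W₁ S k ω - popGrad D ℓ (sgd ℓ η J W₁ S k ω)) |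
    history ℓ η J W₁ S k ⊔ U]

/-- The gradient-sensitivity term `Γ(Λ) = 𝔼[‖ḡ(W + ξ) - ḡ(W)‖²_Λ | H ∨ U]` of update `k`. -/
def gradSensitivity [MeasurableSpace Z] (U : MeasurableSpace Ω) [MeasurableSpace Ω]
    (P : Measure Ω) (D : Measure Z) (ℓ : Param d → Z → ℝ) (η : ℕ → ℝ)
    (J : ℕ → Ω → Multiset (Fin n)) (W₁ : Ω → Param d) (S : Ω → Fin n → Z)
    (ε : ℕ → Ω → Param d) (Λ : Ω → Matrix (Fin d) (Fin d) ℝ) (k : ℕ) : Ω → ℝ :=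
  P[fun ω => sqNorm (Λ ω)
      (popGrad D ℓ (sgd ℓ η J W₁ S k ω + accNoise ℓ η J W₁ S ε k ω)
        - popGrad D ℓ (sgd ℓ η J W₁ S k ω)) |
    history ℓ η J W₁ S k ⊔ U]

/-- The pointwise covariance mismatch `Tr(B⁻¹ A) - d + log (det B / det A)`. -/
def covMismatch (A B : Matrix (Fin d) (Fin d) ℝ) : ℝ :=
  (B⁻¹ * A).trace - d + Real.log (B.det / A.det)

/-- The covariance-comparison cost between the actual covariance `A` and the reference `B`. -/
def covCost [MeasurableSpace Ω] (P : Measure Ω) (A B : Ω → Matrix (Fin d) (Fin d) ℝ) : ℝ :=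
  (1 / 2) * ∫ ω, covMismatch (A ω) (B ω) ∂P

/-- The output sensitivity `𝔼_{ζ ∼ N(0, C)}[L(w, s) - L(w + ζ, s)]`. At `w = W_T ω` and the
accumulated covariance `C ω`, both determined by the final history, this is the conditional
expectation given that history, with a fresh Gaussian perturbation `ζ`. -/
def outputSensitivity (ℓ : Param d → Z → ℝ) (C : Matrix (Fin d) (Fin d) ℝ) (w : Param d)
    (s : Fin n → Z) : ℝ :=
  ∫ ζ, (empRisk ℓ w s - empRisk ℓ (w + ζ) s) ∂(multivariateGaussian 0 C)

/-- The output-sensitivity penalty `|𝔼[Δ(W, S') - Δ(W, S)]|`. -/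
def outputPenalty [MeasurableSpace Ω] (P : Measure Ω) (ℓ : Param d → Z → ℝ)
    (C : Ω → Matrix (Fin d) (Fin d) ℝ) (W : Ω → Param d) (S S' : Ω → Fin n → Z) : ℝ :=
  |∫ ω, (outputSensitivity ℓ (C ω) (W ω) (S' ω) - outputSensitivity ℓ (C ω) (W ω) (S ω)) ∂P|

end Probability

end VirtualSGD

end

/-!
The proof is a change of measure followed by the Donsker-Varadhan inequality. Write `W` for the SGD
path, `W̃` for the virtual path, `b` for the population gradient, and
`h(w, s) = L(w, s) - 𝔼 ℓ(w, Z)` for the centred empirical risk.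

*Decoupling.* Given everything known before `εₖ` is drawn, the virtual step
`W̃ₖ₊₁ = W̃ₖ - ηₖ Gₖ + εₖ` has law `N(W̃ₖ - ηₖ Gₖ, Σₖ)`. Compare it with the reference step, of law
`N(W̃ₖ - ηₖ b(W̃ₖ), Σₖʳᵉᶠ)`, which depends on the virtual path and the auxiliary randomness only.
Let `rₖ` be the ratio of the second density to the first at `W̃ₖ₊₁` (`stepRatio`) and `M = ∏ rₖ`. By
induction on the number of steps, under the measure with density `M` the sample `S` still has the
law `D^n` and is independent of the virtual path (`TiltedIndep.step`, `tiltedIndep_prod_stepRatio`).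
The minibatches enter only through the fact that `Gₖ` is known before `εₖ` is drawn.

*Cost.* `𝔼[-log M]` is a sum of relative entropies between Gaussians, namely
`∑ₖ (𝒞ₖ + ½ 𝔼 ‖ηₖ (Gₖ - b(W̃ₖ))‖²)` in the norm of `(Σₖʳᵉᶠ)⁻¹`
(`HasCondGaussianLaw.integral_neg_log_likelihoodRatio`). The comparison `(Σₖʳᵉᶠ)⁻¹ ≼ κ Σₖ⁻¹`
replaces this norm by that of `κ Σₖ⁻¹`, and `‖x - y‖² ≤ 2 ‖x‖² + 2 ‖y‖²` splits `Gₖ - b(W̃ₖ)` into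
the gradient deviation and the gradient sensitivity (`integral_neg_log_prod_stepRatio_le`). The
comparison also makes every term of `-log M` integrable on its own.

*Entropy inequality.* Let `W̃` denote the last virtual iterate from here on, and `H = h(W̃, S)`.
Under the tilted measure `H` is `R / √n`-sub-Gaussian, and `t H - c ≤ M e^{t H - c} - 1 - log M`
holds pointwise. Integrating and optimizing over `t` gives `(𝔼 H)² ≤ (2 R² / n) 𝔼[-log M]`
(`sq_integral_le_of_lintegral_mul_exp_le`).

*Smoothing.* Given the history and the sample, `W̃ - W` is Gaussian with the accumulated covariance
(`map_sum_noise`), so in averages that involve only the history and the sample, `W̃` may be replaced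
by the output `W` with a fresh perturbation. The ghost sample is independent of the history and the
sample, so its centred risk at the freshly perturbed output averages to zero
(`integral_kernel_ghost_sub`). Hence `gen - 𝔼[Δ(W, S') - Δ(W, S)] = -𝔼 h(W̃, S)`
(`integral_gaussian_empRisk_sub`), and the claim follows from the triangle inequality.
-/

noncomputable section

namespace VirtualSGD

open Real Matrix
open scoped MatrixOrder ENNReal

/-! ### Gaussian densities and moments -/

/-- The Lebesgue density of the centred Gaussian law with covariance `A`. It is meaningful for
positive definite `A`; for singular `A` the prefactor is `0⁻¹ = 0`, so that the value is `0`. -/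
def gaussDensity {d : ℕ} (A : Matrix (Fin d) (Fin d) ℝ) (x : Param d) : ℝ :=
  (√((2 * π) ^ d * A.det))⁻¹ * exp (-(sqNorm A⁻¹ x) / 2)

lemma integrable_exp_neg_sq_norm_half (d : ℕ) :
    Integrable (fun x : Param d => exp (-‖x‖ ^ 2 / 2)) := by
  have h := (GaussianFourier.integrable_cexp_neg_mul_sq_norm_add (V := Param d)
    (b := (1 / 2 : ℂ)) (by norm_num) 0 0).re
  refine h.congr (ae_of_all _ fun x => ?_)
  have : (-(1 / 2 : ℂ) * (‖x‖ : ℂ) ^ 2 + 0 * ((inner ℝ (0 : Param d) x : ℝ) : ℂ))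
      = ((-‖x‖ ^ 2 / 2 : ℝ) : ℂ) := by push_cast; ring
  simp only [this]
  exact Complex.exp_ofReal_re _

/-- Both sides have the same characteristic function, by the Gaussian Fourier integral. -/
lemma stdGaussian_eq_withDensity (d : ℕ) :
    stdGaussian (Param d) = (volume : Measure (Param d)).withDensity
      (fun x => ENNReal.ofReal ((√((2 * π) ^ d))⁻¹ * exp (-‖x‖ ^ 2 / 2))) := by
  have hint := (integrable_exp_neg_sq_norm_half d).const_mul (√((2 * π) ^ d))⁻¹
  have : IsFiniteMeasure ((volume : Measure (Param d)).withDensity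
      (fun x => ENNReal.ofReal ((√((2 * π) ^ d))⁻¹ * exp (-‖x‖ ^ 2 / 2)))) :=
    isFiniteMeasure_withDensity_ofReal hint.2
  apply Measure.ext_of_charFun
  ext t
  rw [charFun_stdGaussian, charFun_apply, integral_withDensity_eq_integral_toReal_smul₀
    (by fun_prop) (ae_of_all _ fun _ => ENNReal.ofReal_lt_top)]
  have hnn : ∀ x : Param d, 0 ≤ (√((2 * π) ^ d))⁻¹ * exp (-‖x‖ ^ 2 / 2) := fun x => by positivity
  simp_rw [ENNReal.toReal_ofReal (hnn _)]
  have key : ∀ x : Param d, ((√((2 * π) ^ d))⁻¹ * exp (-‖x‖ ^ 2 / 2)) •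
      Complex.exp ((inner ℝ x t : ℝ) * Complex.I) = (((√((2 * π) ^ d))⁻¹ : ℝ) : ℂ) *
        Complex.exp (-(1 / 2 : ℂ) * (‖x‖ : ℂ) ^ 2 + Complex.I * ((inner ℝ t x : ℝ) : ℂ)) := by
    intro x
    rw [real_inner_comm, Complex.exp_add, Complex.real_smul]
    push_cast
    rw [show (-(1 / 2 : ℂ) * (‖x‖ : ℂ) ^ 2) = (-(‖x‖ : ℂ) ^ 2 / 2) by ring, mul_comm Complex.I]
    ring
  simp_rw [key]
  rw [integral_const_mul, GaussianFourier.integral_cexp_neg_mul_sq_norm_add (by norm_num)]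
  have h2 : ((π : ℂ) / (1 / 2)) ^ ((Module.finrank ℝ (Param d) : ℂ) / 2)
      = ((√((2 * π) ^ d) : ℝ) : ℂ) := by
    rw [show ((π : ℂ) / (1 / 2)) = ((2 * π : ℝ) : ℂ) by push_cast; ring,
      show ((Module.finrank ℝ (Param d) : ℂ) / 2) = (((d : ℝ) / 2 : ℝ) : ℂ) by simp,
      ← Complex.ofReal_cpow (by positivity), Real.sqrt_eq_rpow, ← Real.rpow_natCast,
      ← Real.rpow_mul (by positivity)]
    congr 2; ring
  rw [h2, ← mul_assoc, ← Complex.ofReal_mul, inv_mul_cancel₀ (by positivity)]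
  simp only [Complex.I_sq, Complex.ofReal_one, one_mul]
  congr 1; ring

/-- The Gaussian law is the image of the standard one under `√A`; change variables with the Jacobian
`det √A`. -/
lemma multivariateGaussian_eq_withDensity {d : ℕ} {A : Matrix (Fin d) (Fin d) ℝ} (hA : A.PosDef) :
    multivariateGaussian 0 A = (volume : Measure (Param d)).withDensity
      (fun x => ENNReal.ofReal (gaussDensity A x)) := by
  set Q := CFC.sqrt A with hQ
  have hQQ : Q * Q = A := CFC.sqrt_mul_sqrt_self _ hA.posSemidef.nonneg
  have hdet : Q.det * Q.det = A.det := by rw [← det_mul, hQQ]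
  have hQ0 : Q.det ≠ 0 := fun h => hA.det_pos.ne' (by rw [← hdet, h, mul_zero])
  have hQu : IsUnit Q.det := hQ0.isUnit
  have hQT : Qᵀ = Q := by
    have := (CFC.sqrt_nonneg A).isSelfAdjoint
    simpa [IsSelfAdjoint, star_eq_conjTranspose, conjTranspose_eq_transpose_of_trivial] using this
  set L := toEuclideanCLM (𝕜 := ℝ) Q with hL
  have hLdet : LinearMap.det (L : Param d →ₗ[ℝ] Param d) = Q.det := by
    rw [hL, coe_toEuclideanCLM_eq_toEuclideanLin, toEuclideanLin, toLpLin_eq_toLin]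
    exact LinearMap.det_toLin _ _
  have hsq : ∀ x : Param d, sqNorm A⁻¹ (L x) = ‖x‖ ^ 2 := by
    intro x
    have h1 : A⁻¹ *ᵥ (Q *ᵥ WithLp.ofLp x) = Q⁻¹ *ᵥ WithLp.ofLp x := by
      rw [← hQQ, Matrix.mul_inv_rev, mulVec_mulVec, Matrix.mul_assoc, nonsing_inv_mul _ hQu,
        mul_one]
    rw [sqNorm, hL, ofLp_toEuclideanCLM, h1, dotProduct_mulVec, ← mulVec_transpose,
      transpose_nonsing_inv, hQT, mulVec_mulVec, nonsing_inv_mul _ hQu, one_mulVec,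
      EuclideanSpace.real_norm_sq_eq, dotProduct]
    simp [sq]
  have hm : Measurable fun x : Param d => sqNorm A⁻¹ x := by
    unfold sqNorm
    apply Continuous.measurable
    fun_prop
  have hdens : Measurable (fun x => ENNReal.ofReal (gaussDensity A x)) := by
    unfold gaussDensity; fun_prop
  ext s hs
  have hLm : Measurable (fun x : Param d => L x) := L.continuous.measurable
  have hdensL : Measurable fun x : Param d => ENNReal.ofReal (gaussDensity A (L x)) :=
    hdens.comp hLm
  simp only [multivariateGaussian, zero_add]
  rw [Measure.map_apply hLm hs, stdGaussian_eq_withDensity, withDensity_apply _ (hLm hs),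
    withDensity_apply _ hs]
  have hmap := Measure.map_linearMap_addHaar_eq_smul_addHaar (volume : Measure (Param d))
    (f := (L : Param d →ₗ[ℝ] Param d)) (by rw [hLdet]; exact hQ0)
  have hc : (√((2 * π) ^ d * A.det))⁻¹ * |Q.det| = (√((2 * π) ^ d))⁻¹ := by
    rw [← hdet, Real.sqrt_mul (by positivity), Real.sqrt_mul_self_eq_abs, mul_inv, mul_assoc,
      inv_mul_cancel₀ (abs_ne_zero.2 hQ0), mul_one]
  have hvol : (volume : Measure (Param d))
      = ENNReal.ofReal |Q.det| • Measure.map (fun x => L x) volume := by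
    rw [show (fun x => L x) = ⇑(L : Param d →ₗ[ℝ] Param d) from rfl, hmap, smul_smul, hLdet,
      ← ENNReal.ofReal_mul (abs_nonneg _), ← abs_mul, mul_inv_cancel₀ hQ0]
    simp
  conv_rhs => rw [hvol]
  rw [Measure.restrict_smul, lintegral_smul_measure, Measure.restrict_map hLm hs,
    lintegral_map hdens hLm, smul_eq_mul, ← lintegral_const_mul _ hdensL]
  refine lintegral_congr fun x => ?_
  rw [← ENNReal.ofReal_mul (abs_nonneg _)]
  congr 1
  rw [gaussDensity, hsq, ← mul_assoc, mul_comm |Q.det|, hc]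

lemma sqNorm_eq_sum {d : ℕ} (B : Matrix (Fin d) (Fin d) ℝ) (x : Param d) :
    sqNorm B x = ∑ i, ∑ j, B i j * (x i * x j) := by
  simp only [sqNorm, dotProduct, mulVec, Finset.mul_sum]
  exact Finset.sum_congr rfl fun i _ => Finset.sum_congr rfl fun j _ => by ring

lemma memLp_eval_multivariateGaussian {d : ℕ} (A : Matrix (Fin d) (Fin d) ℝ) (i : Fin d) :
    MemLp (fun x : Param d => x i) 2 (multivariateGaussian 0 A) :=
  (EuclideanSpace.proj (𝕜 := ℝ) i).comp_memLp' IsGaussian.memLp_two_id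

lemma integral_eval_multivariateGaussian {d : ℕ} (A : Matrix (Fin d) (Fin d) ℝ) (i : Fin d) :
    ∫ x : Param d, x i ∂(multivariateGaussian 0 A) = 0 := by
  have h := (EuclideanSpace.proj (𝕜 := ℝ) i).integral_comp_comm
    (IsGaussian.integrable_id (μ := multivariateGaussian (0 : Param d) A))
  simpa using h

lemma integral_eval_mul_eval_multivariateGaussian {d : ℕ} {A : Matrix (Fin d) (Fin d) ℝ}
    (hA : A.PosSemidef) (i j : Fin d) :
    ∫ x : Param d, x i * x j ∂(multivariateGaussian 0 A) = A i j := by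
  have h := covariance_eval_multivariateGaussian (μ := (0 : Param d)) hA i j
  rw [covariance_eq_sub (memLp_eval_multivariateGaussian A i)
    (memLp_eval_multivariateGaussian A j), integral_eval_multivariateGaussian] at h
  simpa using h

lemma integral_sqNorm_multivariateGaussian {d : ℕ} {A : Matrix (Fin d) (Fin d) ℝ}
    (hA : A.PosSemidef) (B : Matrix (Fin d) (Fin d) ℝ) :
    ∫ x : Param d, sqNorm B x ∂(multivariateGaussian 0 A) = (B * A).trace := by
  have hi : ∀ i j : Fin d, Integrable (fun x : Param d => B i j * (x i * x j))
      (multivariateGaussian 0 A) := fun i j =>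
    ((memLp_eval_multivariateGaussian A i).integrable_mul
      (memLp_eval_multivariateGaussian A j)).const_mul _
  simp_rw [sqNorm_eq_sum]
  rw [integral_finsetSum _ fun i _ => integrable_finsetSum _ fun j _ => hi i j]
  simp_rw [integral_finsetSum _ fun j _ => hi _ j, integral_const_mul,
    integral_eval_mul_eval_multivariateGaussian hA]
  simp only [trace, diag, Matrix.mul_apply]
  refine Finset.sum_congr rfl fun i _ => Finset.sum_congr rfl fun j _ => ?_
  rw [← hA.isHermitian.apply i j]; simp

lemma integral_dotProduct_multivariateGaussian {d : ℕ} (A : Matrix (Fin d) (Fin d) ℝ)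
    (v : Fin d → ℝ) :
    ∫ x : Param d, v ⬝ᵥ WithLp.ofLp x ∂(multivariateGaussian 0 A) = 0 := by
  simp only [dotProduct]
  rw [integral_finsetSum _ fun i _ =>
    ((memLp_eval_multivariateGaussian A i).integrable (by norm_num)).const_mul _]
  simp [integral_const_mul, integral_eval_multivariateGaussian]

lemma multivariateGaussian_conv {d : ℕ} {A B : Matrix (Fin d) (Fin d) ℝ} (hA : A.PosSemidef)
    (hB : B.PosSemidef) :
    (multivariateGaussian (0 : Param d) A) ∗ (multivariateGaussian 0 B)
      = multivariateGaussian 0 (A + B) := by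
  apply Measure.ext_of_charFun
  ext t
  rw [charFun_conv, charFun_multivariateGaussian hA, charFun_multivariateGaussian hB,
    charFun_multivariateGaussian (hA.add hB), ← Complex.exp_add, add_mulVec, dotProduct_add]
  congr 1
  push_cast
  simp
  ring

/-- The degenerate case, needed for a path without updates. -/
lemma multivariateGaussian_zero_zero (d : ℕ) :
    multivariateGaussian (0 : Param d) (0 : Matrix (Fin d) (Fin d) ℝ) = Measure.dirac 0 := by
  apply Measure.ext_of_charFun
  ext t
  rw [charFun_multivariateGaussian Matrix.PosSemidef.zero, charFun_dirac]
  simp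

lemma gaussDensity_pos {d : ℕ} {A : Matrix (Fin d) (Fin d) ℝ} (hA : A.PosDef) (x : Param d) :
    0 < gaussDensity A x := by
  have := hA.det_pos
  unfold gaussDensity
  positivity

lemma lintegral_gaussDensity {d : ℕ} {A : Matrix (Fin d) (Fin d) ℝ} (hA : A.PosDef) :
    ∫⁻ x : Param d, ENNReal.ofReal (gaussDensity A x) = 1 := by
  have h : multivariateGaussian (0 : Param d) A Set.univ = 1 := measure_univ
  rwa [multivariateGaussian_eq_withDensity hA, withDensity_apply _ MeasurableSet.univ,
    Measure.restrict_univ] at h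

/-! ### Measurable dependence on the covariance -/

section Measurability

variable {α : Type*} {mα : MeasurableSpace α} {d : ℕ} {C : α → Matrix (Fin d) (Fin d) ℝ}

lemma MatrixMeasurable.measurable_det (hC : MatrixMeasurable mα C) :
    Measurable fun a => (C a).det := by
  simp only [det_apply]
  exact Finset.measurable_sum _ fun σ _ =>
    (Finset.measurable_prod _ fun i _ => hC _ _).const_smul _

lemma MatrixMeasurable.inv (hC : MatrixMeasurable mα C) :
    MatrixMeasurable mα fun a => (C a)⁻¹ := by
  intro i j
  -- Cramer's rule: the entries are quotients of determinants, with `0⁻¹ = 0` at singular values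
  simp only [inv_def, Matrix.smul_apply, Ring.inverse_eq_inv', smul_eq_mul, adjugate_apply]
  refine hC.measurable_det.inv.mul (MatrixMeasurable.measurable_det fun k l => ?_)
  by_cases h : k = j
  · subst h; simp
  · simpa [updateRow_ne h] using hC k l

lemma MatrixMeasurable.comp {β : Type*} {mβ : MeasurableSpace β} (hC : MatrixMeasurable mα C)
    {f : β → α} (hf : Measurable f) : MatrixMeasurable mβ fun b => C (f b) :=
  fun i j => (hC i j).comp hf

lemma MatrixMeasurable.measurable_sqNorm (hC : MatrixMeasurable mα C) {x : α → Param d}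
    (hx : Measurable x) : Measurable fun a => sqNorm (C a) (x a) := by
  simp only [sqNorm_eq_sum]
  have hxi : ∀ i, Measurable fun a => x a i := fun i =>
    (EuclideanSpace.proj (𝕜 := ℝ) i).continuous.measurable.comp hx
  exact Finset.measurable_sum _ fun i _ => Finset.measurable_sum _ fun j _ =>
    (hC i j).mul ((hxi i).mul (hxi j))

lemma MatrixMeasurable.measurable_gaussDensity (hC : MatrixMeasurable mα C) {x : α → Param d}
    (hx : Measurable x) : Measurable fun a => gaussDensity (C a) (x a) := by
  unfold gaussDensity
  have := hC.measurable_det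
  have := hC.inv.measurable_sqNorm hx
  fun_prop

end Measurability

section Kernel

variable {α : Type*} {mα : MeasurableSpace α} {d : ℕ} {C : α → Matrix (Fin d) (Fin d) ℝ}

lemma MatrixMeasurable.gaussDensity_uncurry (hC : MatrixMeasurable mα C) :
    Measurable (Function.uncurry fun a (x : Param d) => ENNReal.ofReal (gaussDensity (C a) x)) :=
  ((hC.comp measurable_fst).measurable_gaussDensity measurable_snd).ennreal_ofReal

lemma MatrixMeasurable.measurableSet_lintegral_gaussDensity (hC : MatrixMeasurable mα C) :
    MeasurableSet {a | ∫⁻ x : Param d, ENNReal.ofReal (gaussDensity (C a) x) = 1} :=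
  hC.gaussDensity_uncurry.lintegral_prod_right (measurableSet_singleton 1)

/-- The Markov kernel `a ↦ N(0, C a)` for a measurable field `C` of matrices. It is defined through
the density where this has total mass one, and is the Dirac mass at `0` elsewhere. It agrees with
`multivariateGaussian` where `C a` is positive definite or zero, and no claim is made at other
singular matrices: the measurability of `multivariateGaussian` in its covariance is thus avoided. -/
def gaussKernel (hC : MatrixMeasurable mα C) : Kernel α (Param d) := by
  classical
  exact Kernel.piecewise hC.measurableSet_lintegral_gaussDensity
    ((Kernel.const α volume).withDensity fun a x => ENNReal.ofReal (gaussDensity (C a) x))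
    (Kernel.const α (Measure.dirac 0))

instance (hC : MatrixMeasurable mα C) : IsMarkovKernel (gaussKernel hC) := by
  refine ⟨fun a => ⟨?_⟩⟩
  rw [gaussKernel, Kernel.piecewise_apply]
  split_ifs with h
  · rw [Kernel.withDensity_apply _ hC.gaussDensity_uncurry, Kernel.const_apply,
      withDensity_apply _ MeasurableSet.univ, Measure.restrict_univ]
    exact h
  · simp

lemma gaussKernel_apply (hC : MatrixMeasurable mα C) (a : α) :
    gaussKernel hC a = open Classical in
      if ∫⁻ x : Param d, ENNReal.ofReal (gaussDensity (C a) x) = 1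
        then volume.withDensity fun x => ENNReal.ofReal (gaussDensity (C a) x)
        else Measure.dirac 0 := by
  rw [gaussKernel, Kernel.piecewise_apply, Kernel.withDensity_apply _ hC.gaussDensity_uncurry,
    Kernel.const_apply, Kernel.const_apply]
  rfl

lemma gaussKernel_of_posDef (hC : MatrixMeasurable mα C) {a : α} (ha : (C a).PosDef) :
    gaussKernel hC a = multivariateGaussian 0 (C a) := by
  rw [gaussKernel, Kernel.piecewise_apply, if_pos (by exact lintegral_gaussDensity ha),
    Kernel.withDensity_apply _ hC.gaussDensity_uncurry, Kernel.const_apply,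
    multivariateGaussian_eq_withDensity ha]

lemma gaussKernel_of_eq_zero (hC : MatrixMeasurable mα C) {a : α} (ha : C a = 0) :
    gaussKernel hC a = multivariateGaussian 0 (C a) := by
  rcases Nat.eq_zero_or_pos d with rfl | hd
  · have hp : (C a).PosDef := by
      rw [Subsingleton.elim (C a) 1]; exact Matrix.PosDef.one
    exact gaussKernel_of_posDef hC hp
  · have : NeZero d := ⟨hd.ne'⟩
    -- in positive dimension the zero matrix is singular and the density vanishes identically
    have h0 : ∫⁻ x : Param d, ENNReal.ofReal (gaussDensity (C a) x) ≠ 1 := by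
      simp [gaussDensity, ha]
    rw [gaussKernel, Kernel.piecewise_apply, if_neg (by exact h0), Kernel.const_apply, ha,
      multivariateGaussian_zero_zero]

end Kernel

/-! ### Conditionally Gaussian vectors -/

section CondLaw

variable {Ω α : Type*} [mΩ : MeasurableSpace Ω] [mα : MeasurableSpace α] {P : Measure Ω}
  [IsProbabilityMeasure P] {d : ℕ}

/-- A conditional law given `σ(Y)` disintegrates the joint law of `Y` and `X`. Taking for `Y` the
identity map into a coarser sigma-field covers conditioning on an arbitrary sigma-field. -/
lemma HasCondGaussianLaw.map_prodMk_eq_compProd {Y : Ω → α} (hY : Measurable Y)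
    {X : Ω → Param d} (hX : Measurable X) {C : α → Matrix (Fin d) (Fin d) ℝ}
    (hC : MatrixMeasurable mα C) (hpd : ∀ᵐ ω ∂P, (C (Y ω)).PosDef)
    (h : HasCondGaussianLaw (mα.comap Y) P X (fun ω => C (Y ω))) :
    P.map (fun ω => (Y ω, X ω)) = (P.map Y) ⊗ₘ gaussKernel hC := by
  have : IsProbabilityMeasure (P.map Y) := Measure.isProbabilityMeasure_map hY.aemeasurable
  have : IsProbabilityMeasure (P.map fun ω => (Y ω, X ω)) :=
    Measure.isProbabilityMeasure_map (hY.prodMk hX).aemeasurable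
  refine Measure.ext_prod fun {s t} hs ht => ?_
  rw [Measure.map_apply (hY.prodMk hX) (hs.prod ht), Measure.compProd_apply_prod hs ht,
    setLIntegral_map hs (Kernel.measurable_coe _ ht) hY]
  have hset := setIntegral_condExp (hY.comap_le) (f := (X ⁻¹' t).indicator (fun _ => (1 : ℝ)))
    (μ := P) ((integrable_const _).indicator (hX ht)) (s := Y ⁻¹' s) ⟨s, hs, rfl⟩
  rw [setIntegral_congr_ae (hY hs) ((h t ht).mono fun ω hω _ => hω),
    setIntegral_indicator (hX ht), setIntegral_const, smul_eq_mul, mul_one] at hset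
  have hae : ∀ᵐ ω ∂(P.restrict (Y ⁻¹' s)), (multivariateGaussian 0 (C (Y ω))).real t
      = (gaussKernel hC (Y ω) t).toReal := by
    filter_upwards [ae_restrict_of_ae hpd] with ω hω
    rw [gaussKernel_of_posDef hC hω, Measure.real]
  have hlt : ∀ ω, gaussKernel hC (Y ω) t < ∞ := fun ω => measure_lt_top _ _
  have hmk : Measurable fun ω => gaussKernel hC (Y ω) t := (Kernel.measurable_coe _ ht).comp hY
  rw [integral_congr_ae hae, integral_toReal hmk.aemeasurable
    (ae_of_all _ hlt), Measure.real,
    ENNReal.toReal_eq_toReal_iff' _ (measure_ne_top _ _)] at hset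
  · exact hset.symm
  · refine ne_top_of_le_ne_top ENNReal.one_ne_top ?_
    calc ∫⁻ ω in Y ⁻¹' s, gaussKernel hC (Y ω) t ∂P ≤ ∫⁻ ω in Y ⁻¹' s, 1 ∂P :=
          lintegral_mono fun ω => prob_le_one
      _ ≤ 1 := by simpa using prob_le_one

lemma HasCondGaussianLaw.integral_prodMk_of_measurable {Y : Ω → α} (hY : Measurable Y)
    {X : Ω → Param d} (hX : Measurable X) {C : α → Matrix (Fin d) (Fin d) ℝ}
    (hC : MatrixMeasurable mα C) (hpd : ∀ᵐ ω ∂P, (C (Y ω)).PosDef)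
    (h : HasCondGaussianLaw (mα.comap Y) P X (fun ω => C (Y ω))) {F : α × Param d → ℝ}
    (hF : Measurable F) (hint : Integrable (fun ω => F (Y ω, X ω)) P) :
    ∫ ω, F (Y ω, X ω) ∂P = ∫ ω, ∫ x, F (Y ω, x) ∂(multivariateGaussian 0 (C (Y ω))) ∂P := by
  have hYX : Measurable fun ω => (Y ω, X ω) := hY.prodMk hX
  have hF' := hF.stronglyMeasurable
  have h2 : Integrable F (P.map Y ⊗ₘ gaussKernel hC) := by
    rw [← h.map_prodMk_eq_compProd hY hX hC hpd]
    exact (integrable_map_measure hF'.aestronglyMeasurable hYX.aemeasurable).2 hint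
  rw [← integral_map hYX.aemeasurable hF'.aestronglyMeasurable,
    h.map_prodMk_eq_compProd hY hX hC hpd, Measure.integral_compProd h2,
    integral_map hY.aemeasurable hF'.integral_kernel_prod_right'.aestronglyMeasurable]
  exact integral_congr_ae (hpd.mono fun ω hω => by simp only [gaussKernel_of_posDef hC hω])

end CondLaw

section Step

variable {Ω : Type*} {R m mΩ : MeasurableSpace Ω} {P : Measure Ω}
  [IsProbabilityMeasure P] {d : ℕ}

lemma HasCondGaussianLaw.map_prodMk (hm : m ≤ mΩ) {X : Ω → Param d} (hX : Measurable X)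
    {A : Ω → Matrix (Fin d) (Fin d) ℝ} (hA : MatrixMeasurable m A)
    (hpd : ∀ᵐ ω ∂P, (A ω).PosDef) (h : HasCondGaussianLaw m P X A) :
    @Measure.map Ω (Ω × Param d) mΩ (m.prod inferInstance) (fun ω => (ω, X ω)) P
      = (P.trim hm) ⊗ₘ gaussKernel hA := by
  have h' : HasCondGaussianLaw (m.comap id) P X A := by rwa [MeasurableSpace.comap_id]
  have := @HasCondGaussianLaw.map_prodMk_eq_compProd Ω Ω mΩ m P _ d id (measurable_id'' hm) X hX
    A hA hpd h'
  rwa [← trim_eq_map hm] at this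

lemma HasCondGaussianLaw.lintegral_prodMk (hm : m ≤ mΩ) {X : Ω → Param d} (hX : Measurable X)
    {A : Ω → Matrix (Fin d) (Fin d) ℝ} (hA : MatrixMeasurable m A)
    (hpd : ∀ᵐ ω ∂P, (A ω).PosDef) (h : HasCondGaussianLaw m P X A) {F : Ω × Param d → ℝ≥0∞}
    (hF : @Measurable _ _ (m.prod inferInstance) _ F) :
    ∫⁻ ω, F (ω, X ω) ∂P = ∫⁻ ω, ∫⁻ x, F (ω, x) ∂(multivariateGaussian 0 (A ω)) ∂P := by
  have hYm : @Measurable Ω (Ω × Param d) mΩ (m.prod inferInstance) (fun ω => (ω, X ω)) :=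
    (measurable_id'' hm).prodMk hX
  have h1 : ∫⁻ ω, F (ω, X ω) ∂P = @lintegral _ (m.prod inferInstance)
      (@Measure.map Ω (Ω × Param d) mΩ (m.prod inferInstance) (fun ω => (ω, X ω)) P) F :=
    (@lintegral_map _ _ mΩ (m.prod inferInstance) P F _ hF hYm).symm
  rw [h1, h.map_prodMk hm hX hA hpd, Measure.lintegral_compProd hF,
    lintegral_trim hm (Measurable.lintegral_kernel_prod_right' hF)]
  exact lintegral_congr_ae (hpd.mono fun ω hω => by simp only [gaussKernel_of_posDef hA hω])

lemma HasCondGaussianLaw.integral_prodMk (hm : m ≤ mΩ) {X : Ω → Param d} (hX : Measurable X)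
    {A : Ω → Matrix (Fin d) (Fin d) ℝ} (hA : MatrixMeasurable m A)
    (hpd : ∀ᵐ ω ∂P, (A ω).PosDef) (h : HasCondGaussianLaw m P X A) {F : Ω × Param d → ℝ}
    (hF : @Measurable _ _ (m.prod inferInstance) _ F) (hint : Integrable (fun ω => F (ω, X ω)) P) :
    ∫ ω, F (ω, X ω) ∂P = ∫ ω, ∫ x, F (ω, x) ∂(multivariateGaussian 0 (A ω)) ∂P := by
  have h' : HasCondGaussianLaw (m.comap id) P X A := by rwa [MeasurableSpace.comap_id]
  exact @HasCondGaussianLaw.integral_prodMk_of_measurable Ω Ω mΩ m P _ d id (measurable_id'' hm) X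
    hX A hA hpd h' F hF hint

/-! ### Change of measure in one step -/

/-- Change of measure in one Gaussian step: weighting by the likelihood ratio turns a step with mean
`v` and covariance `A` into a step with mean `u` and covariance `B`. -/
lemma HasCondGaussianLaw.lintegral_likelihoodRatio (hm : m ≤ mΩ) {X : Ω → Param d}
    (hX : Measurable X) {A B : Ω → Matrix (Fin d) (Fin d) ℝ} (hA : MatrixMeasurable m A)
    (hApd : ∀ᵐ ω ∂P, (A ω).PosDef) (hB : MatrixMeasurable m B) (hBpd : ∀ᵐ ω ∂P, (B ω).PosDef)
    (h : HasCondGaussianLaw m P X A) {v u : Ω → Param d} (hv : Measurable[m] v)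
    (hu : Measurable[m] u) {M : Ω → ℝ≥0∞} (hM : Measurable[m] M) {F : Ω × Param d → ℝ≥0∞}
    (hF : @Measurable _ _ (m.prod inferInstance) _ F) :
    ∫⁻ ω, M ω * ENNReal.ofReal (gaussDensity (B ω) (v ω + X ω - u ω) / gaussDensity (A ω) (X ω))
        * F (ω, v ω + X ω) ∂P
      = ∫⁻ ω, M ω * ∫⁻ y, F (ω, u ω + y) ∂(gaussKernel hB ω) ∂P := by
  let G : Ω × Param d → ℝ≥0∞ := fun p => M p.1 *
    ENNReal.ofReal (gaussDensity (B p.1) (v p.1 + p.2 - u p.1) / gaussDensity (A p.1) p.2)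
      * F (p.1, v p.1 + p.2)
  have hv1 : @Measurable _ _ (m.prod inferInstance) _ fun p : Ω × Param d => v p.1 + p.2 :=
    (hv.comp measurable_fst).add measurable_snd
  have hG : @Measurable _ _ (m.prod inferInstance) _ G := by
    refine ((hM.comp measurable_fst).mul
      (ENNReal.measurable_ofReal.comp (Measurable.div ?_ ?_))).mul
      (hF.comp (measurable_fst.prodMk hv1))
    · exact (hB.comp measurable_fst).measurable_gaussDensity
        (hv1.sub (hu.comp measurable_fst))
    · exact (hA.comp measurable_fst).measurable_gaussDensity measurable_snd
  refine (h.lintegral_prodMk hm hX hA hApd hG).trans (lintegral_congr_ae ?_)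
  filter_upwards [hApd, hBpd] with ω hAω hBω
  have hsec : Measurable fun x => F (ω, x) := hF.comp (@measurable_prodMk_left _ _ m _ ω)
  have hsec' : Measurable fun y => F (ω, u ω + y) := hsec.comp (measurable_const_add _)
  have hGsec : Measurable fun x => G (ω, x) := hG.comp (@measurable_prodMk_left _ _ m _ ω)
  have hdA : Measurable fun x => ENNReal.ofReal (gaussDensity (A ω) x) :=
    hA.gaussDensity_uncurry.of_uncurry_left (x := ω)
  have hdB : Measurable fun x => ENNReal.ofReal (gaussDensity (B ω) x) :=
    hB.gaussDensity_uncurry.of_uncurry_left (x := ω)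
  rw [gaussKernel_of_posDef hB hBω, multivariateGaussian_eq_withDensity hAω,
    multivariateGaussian_eq_withDensity hBω, lintegral_withDensity_eq_lintegral_mul _ hdA hGsec,
    lintegral_withDensity_eq_lintegral_mul _ hdB hsec']
  have hpt : ∀ x, ((fun x => ENNReal.ofReal (gaussDensity (A ω) x)) * fun x => G (ω, x)) x
      = M ω * (ENNReal.ofReal (gaussDensity (B ω) (x + (v ω - u ω)))
          * F (ω, u ω + (x + (v ω - u ω)))) := by
    intro x
    have hp := gaussDensity_pos hAω x
    have hmul : ENNReal.ofReal (gaussDensity (A ω) x) * ENNReal.ofReal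
        (gaussDensity (B ω) (v ω + x - u ω) / gaussDensity (A ω) x)
        = ENNReal.ofReal (gaussDensity (B ω) (v ω + x - u ω)) := by
      rw [← ENNReal.ofReal_mul hp.le, mul_div_cancel₀ _ hp.ne']
    simp only [Pi.mul_apply, G]
    rw [show x + (v ω - u ω) = v ω + x - u ω by abel,
      show u ω + (v ω + x - u ω) = v ω + x by abel, ← hmul]
    ring
  simp_rw [hpt]
  -- translation invariance of Lebesgue measure recentres the step at `u`
  have hmeas : Measurable fun y => ENNReal.ofReal (gaussDensity (B ω) y) * F (ω, u ω + y) :=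
    hdB.mul hsec'
  have hmeas' : Measurable fun x => ENNReal.ofReal (gaussDensity (B ω) (x + (v ω - u ω)))
      * F (ω, u ω + (x + (v ω - u ω))) := hmeas.comp (measurable_add_const _)
  rw [lintegral_const_mul _ hmeas', lintegral_add_right_eq_self
    (fun y => ENNReal.ofReal (gaussDensity (B ω) y) * F (ω, u ω + y))]
  rfl

/-- Under the measure with density `M` with respect to `P`, the variable `S` has law `μ` and is
independent of the sigma-field `R`. -/
def TiltedIndep {β : Type*} [MeasurableSpace β] (P : Measure Ω) (μ : Measure β) (S : Ω → β)
    (R : MeasurableSpace Ω) (M : Ω → ℝ≥0∞) : Prop :=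
  ∀ f : Ω → ℝ≥0∞, Measurable[R] f → ∀ s : Set β, MeasurableSet s →
    ∫⁻ ω, M ω * f ω * (S ⁻¹' s).indicator 1 ω ∂P = μ s * ∫⁻ ω, M ω * f ω ∂P

/-- Tilted independence survives a conditionally Gaussian step with mean `v` and covariance `A`, if
the density is multiplied by the likelihood ratio against a step with mean `u` and covariance `B`
that are `R`-measurable. The mean `v` may depend on `S`: after the tilt the new point is drawn from
a kernel that sees only `R`. -/
lemma TiltedIndep.step {β : Type*} [MeasurableSpace β] {μ : Measure β} {S : Ω → β}
    {M : Ω → ℝ≥0∞} (hT : TiltedIndep P μ S R M) (hR : R ≤ m)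
    (hm : m ≤ mΩ) (hS : Measurable[m] S) {X : Ω → Param d}
    (hX : Measurable X) {A B : Ω → Matrix (Fin d) (Fin d) ℝ} (hA : MatrixMeasurable m A)
    (hApd : ∀ᵐ ω ∂P, (A ω).PosDef) (hB : MatrixMeasurable R B) (hBpd : ∀ᵐ ω ∂P, (B ω).PosDef)
    (h : HasCondGaussianLaw m P X A) {v u : Ω → Param d} (hv : Measurable[m] v)
    (hu : Measurable[R] u) (hM : Measurable[m] M) :
    TiltedIndep P μ S (R ⊔ MeasurableSpace.comap (fun ω => v ω + X ω) inferInstance)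
        (fun ω => M ω * ENNReal.ofReal
          (gaussDensity (B ω) (v ω + X ω - u ω) / gaussDensity (A ω) (X ω))) ∧
      ∫⁻ ω, M ω * ENNReal.ofReal
          (gaussDensity (B ω) (v ω + X ω - u ω) / gaussDensity (A ω) (X ω)) ∂P
        = ∫⁻ ω, M ω ∂P := by
  have hBm : MatrixMeasurable m B := fun i j => (hB i j).mono hR le_rfl
  have key := fun {F : Ω × Param d → ℝ≥0∞} => h.lintegral_likelihoodRatio hm hX hA hApd hBm hBpd hv
    (hu.mono hR le_rfl) hM (F := F)
  constructor
  · intro f hf s hs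
    have hcomap : R ⊔ MeasurableSpace.comap (fun ω => v ω + X ω) inferInstance
        = MeasurableSpace.comap (fun ω => (ω, v ω + X ω)) (R.prod inferInstance) := by
      rw [MeasurableSpace.prod, MeasurableSpace.comap_sup, MeasurableSpace.comap_comp,
        MeasurableSpace.comap_comp]
      exact congrArg₂ _ MeasurableSpace.comap_id.symm rfl
    rw [hcomap] at hf
    -- an `R ∨ σ(v + X)`-measurable function is a measurable function of `(ω, v ω + X ω)`,
    -- with `R` on the first factor
    obtain ⟨F, hF, rfl⟩ := @Measurable.exists_eq_measurable_comp _ _ _ (R.prod inferInstance) _ _ _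
      _ _ hf
    have hle : R.prod inferInstance ≤ m.prod (inferInstance : MeasurableSpace (Param d)) :=
      sup_le_sup (MeasurableSpace.comap_mono hR) le_rfl
    have hFm : @Measurable _ _ (m.prod inferInstance) _ F := hF.mono hle le_rfl
    have hind : Measurable[m] ((S ⁻¹' s).indicator (1 : Ω → ℝ≥0∞)) :=
      (measurable_const : Measurable[m] fun _ : Ω => (1 : ℝ≥0∞)).indicator (hS hs)
    have k1 := key (F := fun p => F p * (S ⁻¹' s).indicator 1 p.1)
      (hFm.mul (hind.comp (@measurable_fst _ _ m _)))
    have k2 := key hFm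
    simp only [Function.comp_apply, ← mul_assoc] at k1 k2 ⊢
    have hsec : ∀ ω, Measurable fun x => F (ω, x) := fun ω =>
      hFm.comp (@measurable_prodMk_left _ _ m _ ω)
    let g : Ω → ℝ≥0∞ := fun ω => ∫⁻ y, F (ω, u ω + y) ∂(gaussKernel hB ω)
    have hgeq : ∀ ω, ∫⁻ y, F (ω, u ω + y) ∂(gaussKernel hBm ω) = g ω := fun ω => by
      simp only [g, gaussKernel_apply]
    -- integrating out the reference step leaves an `R`-measurable test function
    have hg : Measurable[R] g := by
      refine Measurable.lintegral_kernel_prod_right'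
        (f := fun p : Ω × Param d => F (p.1, u p.1 + p.2))
        (hF.comp (measurable_fst.prodMk ((hu.comp measurable_fst).add measurable_snd)))
    have hg2 : ∀ ω, ∫⁻ y, F (ω, u ω + y) * (S ⁻¹' s).indicator 1 ω ∂(gaussKernel hBm ω)
        = g ω * (S ⁻¹' s).indicator 1 ω := fun ω => by
      have hsec' : Measurable fun y => F (ω, u ω + y) := (hsec ω).comp (measurable_const_add _)
      rw [lintegral_mul_const _ hsec', hgeq]
    simp only [hg2, hgeq] at k1 k2
    rw [k1, k2, ← hT g hg s hs]
    simp only [mul_assoc]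
  · simpa using key (F := fun _ => 1) measurable_const

end Step

/-! ### Measurability of gradients and risks -/

section Gradient

variable {Z : Type*} [MeasurableSpace Z] {d n : ℕ} {ℓ : Param d → Z → ℝ}

lemma measurable_param {α : Type*} {mα : MeasurableSpace α} {f : α → Param d}
    (h : ∀ i, Measurable fun a => f a i) : Measurable f :=
  (WithLp.measurable_toLp 2 _).comp (measurable_pi_iff.2 h)

/-- Joint measurability in the parameter and the data point: each partial derivative is a limit of
difference quotients. -/
lemma measurable_sampleGrad (hℓ : Measurable (Function.uncurry ℓ))
    (hdiff : ∀ z, Differentiable ℝ fun w => ℓ w z) :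
    Measurable (Function.uncurry (sampleGrad ℓ)) := by
  refine measurable_param fun i => ?_
  let e : Param d := EuclideanSpace.single i 1
  refine measurable_of_tendsto_metrizable (f := fun (k : ℕ) (p : Param d × Z) =>
    (k : ℝ) • (ℓ (p.1 + (k : ℝ)⁻¹ • e) p.2 - ℓ p.1 p.2)) (fun k => ?_) ?_
  · have h1 : Measurable fun p : Param d × Z => ℓ (p.1 + (k : ℝ)⁻¹ • e) p.2 :=
      hℓ.comp ((measurable_fst.add_const _).prodMk measurable_snd)
    exact (h1.sub hℓ).const_smul (k : ℝ)
  · refine tendsto_pi_nhds.2 fun p => ?_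
    have h := ((hdiff p.2 p.1).hasFDerivAt.lim_real e).comp tendsto_natCast_atTop_atTop
    have hval : Function.uncurry (sampleGrad ℓ) p i = fderiv ℝ (fun w => ℓ w p.2) p.1 e := by
      have h2 : inner ℝ (gradient (fun w => ℓ w p.2) p.1) e
          = fderiv ℝ (fun w => ℓ w p.2) p.1 e := by
        rw [gradient, InnerProductSpace.toDual_symm_apply]
      rw [← h2, real_inner_comm, EuclideanSpace.inner_single_left]
      simp [Function.uncurry, sampleGrad]
    rw [hval]
    exact h

lemma measurable_popGrad {D : Measure Z} [IsProbabilityMeasure D]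
    (hℓ : Measurable (Function.uncurry ℓ)) (hdiff : ∀ z, Differentiable ℝ fun w => ℓ w z) :
    Measurable (popGrad D ℓ) :=
  ((measurable_sampleGrad hℓ hdiff).stronglyMeasurable.integral_prod_right).measurable

lemma measurable_apply_of_countable {α β γ : Type*} {mα : MeasurableSpace α}
    {mβ : MeasurableSpace β} {mγ : MeasurableSpace γ} [Countable β] [MeasurableSingletonClass β]
    {F : β → α → γ} (hF : ∀ b, Measurable (F b)) {B : α → β} (hB : Measurable B) :
    Measurable fun a => F (B a) a := by
  have h : Measurable fun p : β × α => F p.1 p.2 := measurable_from_prod_countable_right hF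
  exact h.comp (hB.prodMk measurable_id)

lemma measurable_batchGrad {α : Type*} {mα : MeasurableSpace α}
    (hℓ : Measurable (Function.uncurry ℓ)) (hdiff : ∀ z, Differentiable ℝ fun w => ℓ w z)
    {W : α → Param d} (hW : Measurable W) {S : α → Fin n → Z} (hS : Measurable S)
    {B : α → Multiset (Fin n)} (hB : Measurable[mα, ⊤] B) :
    Measurable fun a => batchGrad ℓ (W a) (S a) (B a) := by
  have hg : ∀ i, Measurable fun a => sampleGrad ℓ (W a) (S a i) := fun i =>
    (measurable_sampleGrad hℓ hdiff).comp (hW.prodMk ((measurable_pi_apply i).comp hS))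
  have hsum : ∀ b : Multiset (Fin n),
      Measurable fun a => (b.map fun i => sampleGrad ℓ (W a) (S a i)).sum := by
    intro b
    induction b using Multiset.induction with
    | empty => simp
    | cons i b ih =>
      simp only [Multiset.map_cons, Multiset.sum_cons]
      exact (hg i).add ih
  have hb : ∀ b : Multiset (Fin n), Measurable fun a => batchGrad ℓ (W a) (S a) b := by
    intro b
    unfold batchGrad
    exact (hsum b).const_smul (1 / (b.card : ℝ))
  exact measurable_apply_of_countable (mβ := ⊤) hb hB

lemma measurable_empRisk {α : Type*} {mα : MeasurableSpace α}
    (hℓ : Measurable (Function.uncurry ℓ)) {W : α → Param d} (hW : Measurable W)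
    {S : α → Fin n → Z} (hS : Measurable S) :
    Measurable fun a => empRisk ℓ (W a) (S a) :=
  (Finset.measurable_sum _ fun i _ =>
    hℓ.comp (hW.prodMk ((measurable_pi_apply i).comp hS))).const_mul _

end Gradient

/-! ### The trajectories and their sigma-fields -/

section Dynamics

section

variable {Ω Z : Type*} {U : MeasurableSpace Ω} {d n : ℕ}
  {ℓ : Param d → Z → ℝ} {η : ℕ → ℝ} {J : ℕ → Ω → Multiset (Fin n)} {W₁ : Ω → Param d}
  {S : Ω → Fin n → Z} {ε : ℕ → Ω → Param d}

lemma virtualPath_eq (k : ℕ) (ω : Ω) :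
    virtualPath ℓ η J W₁ S ε k ω = sgd ℓ η J W₁ S k ω + ∑ j ∈ Finset.range k, ε j ω := by
  induction k with
  | zero => simp [virtualPath, sgd]
  | succ k ih =>
    rw [virtualPath, sgd, ih, Finset.sum_range_succ, stochGrad]
    abel

lemma refVisible_succ (k : ℕ) :
    refVisible U ℓ η J W₁ S ε (k + 1) = refVisible U ℓ η J W₁ S ε k ⊔
      MeasurableSpace.comap (virtualPath ℓ η J W₁ S ε (k + 1)) inferInstance := by
  rw [refVisible, Finset.range_add_one, Finset.iSup_insert, refVisible]
  ac_rfl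

lemma measurable_virtualPath_refVisible (k : ℕ) :
    Measurable[refVisible U ℓ η J W₁ S ε k] (virtualPath ℓ η J W₁ S ε k) :=
  (comap_measurable _).mono (le_sup_of_le_left
    (le_iSup₂_of_le k (Finset.mem_range.2 (by omega)) le_rfl)) le_rfl

end

variable {Ω Z : Type*} {U mΩ : MeasurableSpace Ω} [MeasurableSpace Z] {d n N : ℕ}
  {ℓ : Param d → Z → ℝ} {η : ℕ → ℝ} {J : ℕ → Ω → Multiset (Fin n)} {W₁ : Ω → Param d}
  {S : Ω → Fin n → Z} {ε : ℕ → Ω → Param d}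

lemma measurable_sgd (hℓ : Measurable (Function.uncurry ℓ))
    (hdiff : ∀ z, Differentiable ℝ fun w => ℓ w z) (hS : Measurable S) (hW₁ : Measurable W₁)
    (hJ : ∀ k < N, Measurable[mΩ, ⊤] (J k)) : ∀ k ≤ N, Measurable (sgd ℓ η J W₁ S k)
  | 0, _ => hW₁
  | k + 1, hk => by
    have ih := measurable_sgd hℓ hdiff hS hW₁ hJ k (by omega)
    exact ih.sub ((measurable_batchGrad hℓ hdiff ih hS (hJ k hk)).const_smul (η k))

lemma history_le (hℓ : Measurable (Function.uncurry ℓ))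
    (hdiff : ∀ z, Differentiable ℝ fun w => ℓ w z) (hS : Measurable S) (hW₁ : Measurable W₁)
    (hJ : ∀ k < N, Measurable[mΩ, ⊤] (J k)) {r : ℕ} (hr : r ≤ N) :
    history ℓ η J W₁ S r ≤ mΩ := by
  have hsgd := measurable_sgd (η := η) hℓ hdiff hS hW₁ hJ
  refine sup_le (iSup₂_le fun k hk => ?_) (iSup₂_le fun k hk => ?_)
  · exact (hsgd k (by have := Finset.mem_range.1 hk; omega)).comap_le
  · have hk' : k < N := lt_of_lt_of_le (Finset.mem_range.1 hk) hr
    refine sup_le (sup_le (hJ k hk').comap_le (Measurable.comap_le ?_)) (Measurable.comap_le ?_)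
    · refine measurable_pi_iff.2 fun i => Measurable.ite ?_ ?_ measurable_const
      · exact hJ k hk' (t := {B | i ∈ B}) trivial
      · exact measurable_inl.comp ((measurable_pi_apply i).comp hS)
    · exact measurable_batchGrad hℓ hdiff (hsgd k hk'.le) hS (hJ k hk')

lemma measurable_sgd_history {k r : ℕ} (h : k ≤ r) :
    Measurable[history ℓ η J W₁ S r] (sgd ℓ η J W₁ S k) :=
  (comap_measurable _).mono
    (le_sup_of_le_left (le_iSup₂_of_le k (Finset.mem_range.2 (by omega)) le_rfl)) le_rfl

lemma measurable_stochGrad_history {k r : ℕ} (h : k < r) :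
    Measurable[history ℓ η J W₁ S r] (stochGrad ℓ η J W₁ S k) :=
  (comap_measurable _).mono (le_sup_of_le_right
    (le_iSup₂_of_le k (Finset.mem_range.2 h) le_sup_right)) le_rfl

lemma history_mono {k r : ℕ} (h : k ≤ r) :
    history ℓ η J W₁ S k ≤ history ℓ η J W₁ S r :=
  sup_le_sup
    (biSup_mono fun j hj => Finset.mem_range.2 (by have := Finset.mem_range.1 hj; omega))
    (biSup_mono fun j hj => Finset.mem_range.2 (by have := Finset.mem_range.1 hj; omega))

/-- Everything that is known when the perturbation `ε k` is drawn: the whole real history, the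
sample, the auxiliary randomness and the earlier perturbations. -/
@[reducible] def noiseHistory (U : MeasurableSpace Ω) (ℓ : Param d → Z → ℝ) (η : ℕ → ℝ)
    (J : ℕ → Ω → Multiset (Fin n)) (W₁ : Ω → Param d) (S : Ω → Fin n → Z) (N : ℕ)
    (ε : ℕ → Ω → Param d) (k : ℕ) : MeasurableSpace Ω :=
  history ℓ η J W₁ S N ⊔ MeasurableSpace.comap S inferInstance ⊔ U ⊔
      ⨆ j ∈ Finset.range k, MeasurableSpace.comap (ε j) inferInstance

lemma history_sup_comap_le_noiseHistory (k : ℕ) :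
    history ℓ η J W₁ S N ⊔ MeasurableSpace.comap S inferInstance
      ≤ noiseHistory U ℓ η J W₁ S N ε k :=
  le_sup_of_le_left le_sup_left

lemma noiseHistory_mono {k r : ℕ} (h : k ≤ r) :
    noiseHistory U ℓ η J W₁ S N ε k ≤ noiseHistory U ℓ η J W₁ S N ε r :=
  sup_le_sup le_rfl
    (biSup_mono fun j hj => Finset.mem_range.2 (by have := Finset.mem_range.1 hj; omega))

lemma noiseHistory_le (hH : history ℓ η J W₁ S N ≤ mΩ) (hS : Measurable S) (hU : U ≤ mΩ)
    (hε : ∀ k < N, Measurable (ε k)) {k : ℕ} (hk : k ≤ N) :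
    noiseHistory U ℓ η J W₁ S N ε k ≤ mΩ :=
  sup_le (sup_le (sup_le hH hS.comap_le) hU)
    (iSup₂_le fun j hj => (hε j (lt_of_lt_of_le (Finset.mem_range.1 hj) hk)).comap_le)

lemma measurable_noise_noiseHistory {j k : ℕ} (h : j < k) :
    Measurable[noiseHistory U ℓ η J W₁ S N ε k] (ε j) :=
  (comap_measurable _).mono
    (le_sup_of_le_right (le_iSup₂_of_le j (Finset.mem_range.2 h) le_rfl)) le_rfl

lemma measurable_sample_noiseHistory (k : ℕ) :
    Measurable[noiseHistory U ℓ η J W₁ S N ε k] S :=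
  (comap_measurable _).mono (le_sup_of_le_left (le_sup_of_le_left le_sup_right)) le_rfl

lemma measurable_virtualPath_noiseHistory {k : ℕ} (h : k ≤ N) :
    Measurable[noiseHistory U ℓ η J W₁ S N ε k] (virtualPath ℓ η J W₁ S ε k) := by
  have : virtualPath ℓ η J W₁ S ε k = fun ω => sgd ℓ η J W₁ S k ω + ∑ j ∈ Finset.range k, ε j ω :=
    funext fun ω => virtualPath_eq k ω
  rw [this]
  refine Measurable.add ((measurable_sgd_history h).mono
    (le_sup_left.trans (history_sup_comap_le_noiseHistory k)) le_rfl) ?_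
  exact Finset.measurable_sum _ fun j hj => measurable_noise_noiseHistory (Finset.mem_range.1 hj)

lemma refVisible_le_noiseHistory {k : ℕ} (h : k ≤ N) :
    refVisible U ℓ η J W₁ S ε k ≤ noiseHistory U ℓ η J W₁ S N ε k := by
  refine sup_le (iSup₂_le fun j hj => ?_) (le_sup_of_le_left le_sup_right)
  have hj' := Finset.mem_range.1 hj
  exact Measurable.comap_le ((measurable_virtualPath_noiseHistory (by omega)).mono
    (noiseHistory_mono (by omega)) le_rfl)

end Dynamics

/-! ### Quadratic forms and Gaussian relative entropy -/

section Quadratic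

variable {d : ℕ} {M M' A B : Matrix (Fin d) (Fin d) ℝ}

lemma sqNorm_nonneg (hM : M.PosSemidef) (x : Param d) : 0 ≤ sqNorm M x := by
  simpa [sqNorm] using hM.dotProduct_mulVec_nonneg (WithLp.ofLp x)

lemma sqNorm_le_sqNorm (h : (M' - M).PosSemidef) (x : Param d) : sqNorm M x ≤ sqNorm M' x := by
  have := sqNorm_nonneg h x
  rw [sqNorm, sub_mulVec, dotProduct_sub] at this
  exact sub_nonneg.1 this

lemma sqNorm_smul_left (c : ℝ) (M : Matrix (Fin d) (Fin d) ℝ) (x : Param d) :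
    sqNorm (c • M) x = c * sqNorm M x := by
  rw [sqNorm, smul_mulVec, dotProduct_smul, smul_eq_mul, sqNorm]

lemma sqNorm_smul_right (c : ℝ) (M : Matrix (Fin d) (Fin d) ℝ) (x : Param d) :
    sqNorm M (c • x) = c ^ 2 * sqNorm M x := by
  simp [sqNorm, mulVec_smul]
  ring

lemma sqNorm_add_add_sqNorm_sub (M : Matrix (Fin d) (Fin d) ℝ) (x y : Param d) :
    sqNorm M (x + y) + sqNorm M (x - y) = 2 * sqNorm M x + 2 * sqNorm M y := by
  simp only [sqNorm, WithLp.ofLp_add, WithLp.ofLp_sub, mulVec_add, mulVec_sub, add_dotProduct,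
    dotProduct_add, sub_dotProduct, dotProduct_sub]
  ring

lemma sqNorm_sub_le (hM : M.PosSemidef) (x y : Param d) :
    sqNorm M (x - y) ≤ 2 * sqNorm M x + 2 * sqNorm M y := by
  linarith [sqNorm_add_add_sqNorm_sub M x y, sqNorm_nonneg hM (x + y)]

lemma integrable_sqNorm_multivariateGaussian (A B : Matrix (Fin d) (Fin d) ℝ) :
    Integrable (fun x : Param d => sqNorm B x) (multivariateGaussian 0 A) := by
  simp_rw [sqNorm_eq_sum]
  exact integrable_finsetSum _ fun i _ => integrable_finsetSum _ fun j _ =>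
    ((memLp_eval_multivariateGaussian A i).integrable_mul
      (memLp_eval_multivariateGaussian A j)).const_mul _

lemma integrable_dotProduct_multivariateGaussian (A : Matrix (Fin d) (Fin d) ℝ) (v : Fin d → ℝ) :
    Integrable (fun x : Param d => v ⬝ᵥ WithLp.ofLp x) (multivariateGaussian 0 A) := by
  simp only [dotProduct]
  exact integrable_finsetSum _ fun i _ =>
    ((memLp_eval_multivariateGaussian A i).integrable (by norm_num)).const_mul _

lemma integral_sqNorm_sub_multivariateGaussian (hA : A.PosSemidef)
    (M : Matrix (Fin d) (Fin d) ℝ) (δ : Param d) :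
    ∫ x : Param d, sqNorm M (x - δ) ∂(multivariateGaussian 0 A)
      = (M * A).trace + sqNorm M δ := by
  have h : ∀ x : Param d, sqNorm M (x - δ) = (sqNorm M x + sqNorm M δ)
      - (M *ᵥ WithLp.ofLp δ + WithLp.ofLp δ ᵥ* M) ⬝ᵥ WithLp.ofLp x := by
    intro x
    simp only [sqNorm, WithLp.ofLp_sub, mulVec_sub, sub_dotProduct, dotProduct_sub, add_dotProduct]
    rw [dotProduct_comm (M *ᵥ WithLp.ofLp δ), dotProduct_mulVec (WithLp.ofLp δ) M (WithLp.ofLp x)]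
    ring
  simp_rw [h]
  have h1 := integrable_sqNorm_multivariateGaussian A M
  have h2 := integrable_dotProduct_multivariateGaussian A
    (M *ᵥ WithLp.ofLp δ + WithLp.ofLp δ ᵥ* M)
  have h3 : Integrable (fun x => sqNorm M x + sqNorm M δ) (multivariateGaussian 0 A) :=
    h1.add (integrable_const _)
  rw [integral_sub h3 h2, integral_add h1 (integrable_const _),
    integral_dotProduct_multivariateGaussian, integral_sqNorm_multivariateGaussian hA]
  simp

/-- The trace is bounded by a constant, hence integrable in the random setting without any further
assumption. -/
lemma trace_inv_mul_mem_Icc {κ : ℝ} (hA : A.PosDef) (hB : B.PosDef)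
    (h : (κ • A⁻¹ - B⁻¹).PosSemidef) : (B⁻¹ * A).trace ∈ Set.Icc 0 (κ * d) := by
  -- write the trace as a Gaussian average of `‖x‖²`, where the comparison is pointwise
  rw [← integral_sqNorm_multivariateGaussian hA.posSemidef]
  refine ⟨integral_nonneg fun x => sqNorm_nonneg hB.inv.posSemidef x, ?_⟩
  have htr : (A⁻¹ * A).trace = d := by
    rw [nonsing_inv_mul _ hA.det_pos.ne'.isUnit, trace_one, Fintype.card_fin]
  rw [← htr, ← integral_sqNorm_multivariateGaussian hA.posSemidef, ← integral_const_mul]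
  refine integral_mono (integrable_sqNorm_multivariateGaussian _ _)
    ((integrable_sqNorm_multivariateGaussian _ _).const_mul _) fun x => ?_
  simpa only [sqNorm_smul_left] using sqNorm_le_sqNorm h x

lemma neg_log_gaussDensity_div (hA : A.PosDef) (hB : B.PosDef) (x y : Param d) :
    -log (gaussDensity B y / gaussDensity A x)
      = (1 / 2) * (log (B.det / A.det) + sqNorm B⁻¹ y - sqNorm A⁻¹ x) := by
  have hAd := hA.det_pos
  have hBd := hB.det_pos
  have h : ∀ {C : Matrix (Fin d) (Fin d) ℝ}, 0 < C.det → ∀ z : Param d, log (gaussDensity C z)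
      = -(1 / 2) * (log ((2 * π) ^ d) + log C.det) - sqNorm C⁻¹ z / 2 := by
    intro C hC z
    rw [gaussDensity, log_mul (by positivity) (exp_pos _).ne', log_inv, log_sqrt (by positivity),
      log_exp, log_mul (by positivity) hC.ne']
    ring
  rw [log_div (gaussDensity_pos hB y).ne' (gaussDensity_pos hA x).ne', h hAd, h hBd,
    log_div hBd.ne' hAd.ne']
  ring

end Quadratic

section StepCost

variable {Ω : Type*} {m mΩ : MeasurableSpace Ω} {P : Measure Ω} [IsProbabilityMeasure P] {d : ℕ}

lemma HasCondGaussianLaw.integrable_sqNorm_inv (hm : m ≤ mΩ) {X : Ω → Param d}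
    (hX : Measurable X) {A : Ω → Matrix (Fin d) (Fin d) ℝ} (hA : MatrixMeasurable m A)
    (hApd : ∀ᵐ ω ∂P, (A ω).PosDef) (h : HasCondGaussianLaw m P X A) :
    Integrable (fun ω => sqNorm (A ω)⁻¹ (X ω)) P ∧ ∫ ω, sqNorm (A ω)⁻¹ (X ω) ∂P = d := by
  have hmeas : @Measurable _ _ (m.prod inferInstance) _
      fun p : Ω × Param d => sqNorm (A p.1)⁻¹ p.2 :=
    (hA.inv.comp measurable_fst).measurable_sqNorm measurable_snd
  have htr : ∀ {C : Matrix (Fin d) (Fin d) ℝ}, C.PosDef →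
      ∫ x : Param d, sqNorm C⁻¹ x ∂(multivariateGaussian 0 C) = d := fun {C} hC => by
    rw [integral_sqNorm_multivariateGaussian hC.posSemidef,
      nonsing_inv_mul _ hC.det_pos.ne'.isUnit, trace_one, Fintype.card_fin]
  have hint : Integrable (fun ω => sqNorm (A ω)⁻¹ (X ω)) P := by
    refine ⟨((hA.inv.comp (measurable_id'' hm)).measurable_sqNorm hX).aestronglyMeasurable, ?_⟩
    rw [hasFiniteIntegral_iff_ofReal (hApd.mono fun ω hω => sqNorm_nonneg hω.inv.posSemidef _),
      h.lintegral_prodMk hm hX hA hApd (F := fun p => ENNReal.ofReal (sqNorm (A p.1)⁻¹ p.2))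
        hmeas.ennreal_ofReal]
    have : ∀ᵐ ω ∂P, ∫⁻ x : Param d, ENNReal.ofReal (sqNorm (A ω)⁻¹ x)
        ∂(multivariateGaussian 0 (A ω)) = ENNReal.ofReal d := by
      filter_upwards [hApd] with ω hω
      rw [← ofReal_integral_eq_lintegral_ofReal (integrable_sqNorm_multivariateGaussian _ _)
        (ae_of_all _ fun x => sqNorm_nonneg hω.inv.posSemidef x), htr hω]
    rw [lintegral_congr_ae this]
    simp
  refine ⟨hint, ?_⟩
  rw [h.integral_prodMk hm hX hA hApd (F := fun p => sqNorm (A p.1)⁻¹ p.2) hmeas hint,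
    integral_congr_ae (hApd.mono fun ω hω => htr hω)]
  simp

/-- The entropy cost of one step: the relative entropy of `N(0, A)` with respect to `N(δ, B)`,
averaged over the conditioning. The comparison of `A` and `B` makes the trace, the quadratic terms
and (through `covMismatch`) the log-determinant integrable one by one. -/
lemma HasCondGaussianLaw.integral_neg_log_likelihoodRatio (hm : m ≤ mΩ) {X : Ω → Param d}
    (hX : Measurable X) {A B : Ω → Matrix (Fin d) (Fin d) ℝ} (hA : MatrixMeasurable m A)
    (hApd : ∀ᵐ ω ∂P, (A ω).PosDef) (hB : MatrixMeasurable m B) (hBpd : ∀ᵐ ω ∂P, (B ω).PosDef)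
    (h : HasCondGaussianLaw m P X A) {δ : Ω → Param d} (hδ : Measurable[m] δ) {κ : ℝ}
    (hcomp : ∀ᵐ ω ∂P, (κ • (A ω)⁻¹ - (B ω)⁻¹).PosSemidef)
    (hcov : Integrable (fun ω => covMismatch (A ω) (B ω)) P)
    (hδint : Integrable (fun ω => sqNorm (B ω)⁻¹ (δ ω)) P) :
    Integrable (fun ω => -log (gaussDensity (B ω) (X ω - δ ω) / gaussDensity (A ω) (X ω))) P ∧
      ∫ ω, -log (gaussDensity (B ω) (X ω - δ ω) / gaussDensity (A ω) (X ω)) ∂P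
        = covCost P A B + (1 / 2) * ∫ ω, sqNorm (B ω)⁻¹ (δ ω) ∂P := by
  obtain ⟨hX1, hX1e⟩ := h.integrable_sqNorm_inv hm hX hA hApd
  have hBΩ : MatrixMeasurable mΩ fun ω => (B ω)⁻¹ := hB.inv.comp (measurable_id'' hm)
  have hδΩ : Measurable δ := hδ.mono hm le_rfl
  have hX2 : Integrable (fun ω => sqNorm (B ω)⁻¹ (X ω)) P := by
    refine (hX1.const_mul κ).mono' (hBΩ.measurable_sqNorm hX).aestronglyMeasurable ?_
    filter_upwards [hBpd, hcomp] with ω hBω hω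
    rw [Real.norm_of_nonneg (sqNorm_nonneg hBω.inv.posSemidef _), ← sqNorm_smul_left]
    exact sqNorm_le_sqNorm hω _
  have hY : Integrable (fun ω => sqNorm (B ω)⁻¹ (X ω - δ ω)) P := by
    refine ((hX2.const_mul 2).add (hδint.const_mul 2)).mono'
      (hBΩ.measurable_sqNorm (hX.sub hδΩ)).aestronglyMeasurable ?_
    filter_upwards [hBpd] with ω hBω
    rw [Real.norm_of_nonneg (sqNorm_nonneg hBω.inv.posSemidef _)]
    exact sqNorm_sub_le hBω.inv.posSemidef _ _
  have htrm : Measurable fun ω => ((B ω)⁻¹ * A ω).trace := by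
    simp only [trace, diag, Matrix.mul_apply]
    exact Finset.measurable_sum _ fun i _ => Finset.measurable_sum _ fun j _ =>
      (hBΩ i j).mul ((hA j i).mono hm le_rfl)
  have htr : Integrable (fun ω => ((B ω)⁻¹ * A ω).trace) P := by
    refine (integrable_const (κ * d)).mono' htrm.aestronglyMeasurable ?_
    filter_upwards [hApd, hBpd, hcomp] with ω hAω hBω hω
    have := trace_inv_mul_mem_Icc hAω hBω hω
    rw [Real.norm_of_nonneg this.1]
    exact this.2
  have hYe : ∫ ω, sqNorm (B ω)⁻¹ (X ω - δ ω) ∂P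
      = ∫ ω, ((B ω)⁻¹ * A ω).trace ∂P + ∫ ω, sqNorm (B ω)⁻¹ (δ ω) ∂P := by
    rw [← integral_add htr hδint, h.integral_prodMk hm hX hA hApd
      (F := fun p => sqNorm (B p.1)⁻¹ (p.2 - δ p.1)) ?_ hY]
    · exact integral_congr_ae (hApd.mono fun ω hω =>
        integral_sqNorm_sub_multivariateGaussian hω.posSemidef (B ω)⁻¹ (δ ω))
    · exact (hB.inv.comp measurable_fst).measurable_sqNorm
        (measurable_snd.sub (hδ.comp measurable_fst))
  have heq : (fun ω => -log (gaussDensity (B ω) (X ω - δ ω) / gaussDensity (A ω) (X ω)))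
      =ᵐ[P] fun ω => (1 / 2) * (covMismatch (A ω) (B ω) - ((B ω)⁻¹ * A ω).trace + d
        + sqNorm (B ω)⁻¹ (X ω - δ ω) - sqNorm (A ω)⁻¹ (X ω)) := by
    filter_upwards [hApd, hBpd] with ω hAω hBω
    rw [neg_log_gaussDensity_div hAω hBω, covMismatch]
    ring
  have hi1 : Integrable (fun ω => covMismatch (A ω) (B ω) - ((B ω)⁻¹ * A ω).trace) P :=
    hcov.sub htr
  have hi2 : Integrable (fun ω => covMismatch (A ω) (B ω) - ((B ω)⁻¹ * A ω).trace + d) P :=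
    hi1.add (integrable_const (d : ℝ))
  have hi3 : Integrable (fun ω => covMismatch (A ω) (B ω) - ((B ω)⁻¹ * A ω).trace + d
      + sqNorm (B ω)⁻¹ (X ω - δ ω)) P :=
    hi2.add hY
  refine ⟨((hi3.sub hX1).const_mul (1 / 2)).congr heq.symm, ?_⟩
  rw [integral_congr_ae heq, integral_const_mul]
  have e : ∫ ω, (covMismatch (A ω) (B ω) - ((B ω)⁻¹ * A ω).trace + d
        + sqNorm (B ω)⁻¹ (X ω - δ ω) - sqNorm (A ω)⁻¹ (X ω)) ∂P
      = ∫ ω, covMismatch (A ω) (B ω) ∂P - ∫ ω, ((B ω)⁻¹ * A ω).trace ∂P + d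
        + ∫ ω, sqNorm (B ω)⁻¹ (X ω - δ ω) ∂P - ∫ ω, sqNorm (A ω)⁻¹ (X ω) ∂P := by
    rw [integral_sub hi3 hX1, integral_add hi2 hY, integral_add hi1 (integrable_const _),
      integral_sub hcov htr]
    simp
  rw [e, hYe, hX1e, covCost]
  ring

end StepCost

/-! ### The entropy inequality -/

section ChangeOfMeasure

variable {Ω : Type*} {R mΩ : MeasurableSpace Ω} {P : Measure Ω}

/-- Donsker-Varadhan inequality for a variable that is sub-Gaussian under the measure with density
`M`. The right-hand integral is the relative entropy of `P` with respect to that measure. -/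
lemma sq_integral_le_of_lintegral_mul_exp_le [IsProbabilityMeasure P] {M H : Ω → ℝ}
    (hM : ∀ᵐ ω ∂P, 0 < M ω)
    (hMm : Measurable M) (hHm : Measurable H) (hlog : Integrable (fun ω => -log (M ω)) P) {σ : ℝ}
    (h : ∀ t : ℝ, ∫⁻ ω, ENNReal.ofReal (M ω * exp (t * H ω)) ∂P
      ≤ ENNReal.ofReal (exp (σ * t ^ 2 / 2))) :
    Integrable H P ∧ (∫ ω, H ω ∂P) ^ 2 ≤ 2 * σ * ∫ ω, -log (M ω) ∂P := by
  have hnn : ∀ t : ℝ, 0 ≤ᵐ[P] fun ω => M ω * exp (t * H ω) := fun t =>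
    hM.mono fun ω hω => (mul_pos hω (exp_pos _)).le
  have hexp : ∀ t : ℝ, Integrable (fun ω => M ω * exp (t * H ω)) P := fun t => by
    refine ⟨by fun_prop, ?_⟩
    rw [hasFiniteIntegral_iff_ofReal (hnn t)]
    exact (h t).trans_lt ENNReal.ofReal_lt_top
  have hexp_le : ∀ t : ℝ, ∫ ω, M ω * exp (t * H ω) ∂P ≤ exp (σ * t ^ 2 / 2) := fun t => by
    rw [integral_eq_lintegral_of_nonneg_ae (hnn t) (hexp t).1]
    exact ENNReal.toReal_le_of_le_ofReal (exp_pos _).le (h t)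
  -- the variational inequality, pointwise: `1 + x ≤ exp x` at `x = t H - c + log M`
  have hpt : ∀ t c : ℝ, ∀ᵐ ω ∂P,
      t * H ω - c ≤ exp (-c) * (M ω * exp (t * H ω)) - 1 + -log (M ω) := by
    intro t c
    filter_upwards [hM] with ω hω
    have h1 := add_one_le_exp (t * H ω - c + log (M ω))
    rw [exp_add, exp_log hω, sub_eq_add_neg, exp_add] at h1
    nlinarith
  have hg : ∀ t c : ℝ, Integrable
      (fun ω => exp (-c) * (M ω * exp (t * H ω)) - 1 + -log (M ω)) P := fun t c =>
    (((hexp t).const_mul _).sub (integrable_const 1)).add hlog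
  have hH : Integrable H P := by
    refine ((hg 1 0).abs.add (hg (-1) 0).abs).mono' hHm.aestronglyMeasurable ?_
    filter_upwards [hpt 1 0, hpt (-1) 0] with ω h1 h2
    rw [Real.norm_eq_abs]
    refine abs_le.2 ⟨?_, ?_⟩
    · simp only [Pi.add_apply]
      have := le_abs_self (exp (-0) * (M ω * exp (-1 * H ω)) - 1 + -log (M ω))
      have := abs_nonneg (exp (-0) * (M ω * exp (1 * H ω)) - 1 + -log (M ω))
      linarith
    · simp only [Pi.add_apply]
      have := le_abs_self (exp (-0) * (M ω * exp (1 * H ω)) - 1 + -log (M ω))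
      have := abs_nonneg (exp (-0) * (M ω * exp (-1 * H ω)) - 1 + -log (M ω))
      linarith
  refine ⟨hH, ?_⟩
  -- with `c = σ t² / 2` the exponential term integrates to at most `1`; the resulting quadratic in
  -- `t` is nonnegative, so its discriminant is nonpositive
  have hquad : ∀ t : ℝ, 0 ≤ σ / 2 * (t * t) + (-∫ ω, H ω ∂P) * t + ∫ ω, -log (M ω) ∂P := by
    intro t
    have h1 : ∫ ω, (t * H ω - σ * t ^ 2 / 2) ∂P ≤ ∫ ω, (exp (-(σ * t ^ 2 / 2))
        * (M ω * exp (t * H ω)) - 1 + -log (M ω)) ∂P :=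
      integral_mono_ae ((hH.const_mul t).sub (integrable_const (σ * t ^ 2 / 2)))
      (hg t (σ * t ^ 2 / 2)) (hpt t (σ * t ^ 2 / 2))
    have h3 : Integrable (fun ω => exp (-(σ * t ^ 2 / 2)) * (M ω * exp (t * H ω)) - 1) P :=
      ((hexp t).const_mul _).sub (integrable_const 1)
    rw [integral_sub (hH.const_mul t) (integrable_const _), integral_const_mul,
      integral_add h3 hlog, integral_sub ((hexp t).const_mul _) (integrable_const 1),
      integral_const_mul] at h1
    have h2 : exp (-(σ * t ^ 2 / 2)) * ∫ ω, M ω * exp (t * H ω) ∂P ≤ 1 := by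
      calc _ ≤ exp (-(σ * t ^ 2 / 2)) * exp (σ * t ^ 2 / 2) :=
            mul_le_mul_of_nonneg_left (hexp_le t) (exp_pos _).le
        _ = 1 := by rw [← exp_add]; simp
    simp only [integral_const, probReal_univ, smul_eq_mul, one_mul] at h1
    nlinarith
  have := discrim_le_zero hquad
  rw [discrim] at this
  nlinarith

/-- Under the tilted measure the pair `(W, S)` has a product law, so a bound that holds for each
frozen `w` holds for the random `W`. -/
lemma TiltedIndep.lintegral_mul_le {β γ : Type*} [MeasurableSpace β] [MeasurableSpace γ]
    {μ : Measure β} [IsProbabilityMeasure μ] {S : Ω → β} {M : Ω → ℝ≥0∞}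
    (hT : TiltedIndep P μ S R M) (hS : Measurable S)
    (hR : R ≤ mΩ) (hM : Measurable M) (hM1 : ∫⁻ ω, M ω ∂P = 1) {W : Ω → γ} (hW : Measurable[R] W)
    {F : γ × β → ℝ≥0∞} (hF : Measurable F) {b : ℝ≥0∞} (hb : ∀ w, ∫⁻ s, F (w, s) ∂μ ≤ b) :
    ∫⁻ ω, M ω * F (W ω, S ω) ∂P ≤ b := by
  have hWΩ : Measurable W := hW.mono hR le_rfl
  set Q := P.withDensity M with hQ
  have : IsProbabilityMeasure Q := ⟨by
    rw [hQ, withDensity_apply _ MeasurableSet.univ, Measure.restrict_univ, hM1]⟩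
  have : IsProbabilityMeasure (Q.map W) := Measure.isProbabilityMeasure_map hWΩ.aemeasurable
  have hprod : (Q.map W).prod μ = Q.map fun ω => (W ω, S ω) := by
    refine Measure.prod_eq fun s t hs ht => ?_
    have h1 := hT ((W ⁻¹' s).indicator 1)
      ((measurable_const : Measurable[R] fun _ : Ω => (1 : ℝ≥0∞)).indicator (hW hs)) t ht
    rw [Measure.map_apply (hWΩ.prodMk hS) (hs.prod ht), Measure.map_apply hWΩ hs, hQ,
      withDensity_apply _ (hWΩ.prodMk hS (hs.prod ht)), withDensity_apply _ (hWΩ hs), mul_comm,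
      ← lintegral_indicator (hWΩ hs), ← lintegral_indicator (hWΩ.prodMk hS (hs.prod ht))]
    convert h1 using 1
    · refine lintegral_congr fun ω => ?_
      by_cases h1 : W ω ∈ s <;> by_cases h2 : S ω ∈ t <;> simp [Set.indicator, h1, h2]
    · congr 1
      refine lintegral_congr fun ω => ?_
      by_cases h1 : W ω ∈ s <;> simp [Set.indicator, h1]
  have hFWS : Measurable fun ω => F (W ω, S ω) := hF.comp (hWΩ.prodMk hS)
  calc ∫⁻ ω, M ω * F (W ω, S ω) ∂P = ∫⁻ ω, F (W ω, S ω) ∂Q := by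
        rw [hQ, lintegral_withDensity_eq_lintegral_mul _ hM hFWS]
        rfl
    _ = ∫⁻ p, F p ∂((Q.map W).prod μ) := by rw [hprod, lintegral_map hF (hWΩ.prodMk hS)]
    _ = ∫⁻ w, ∫⁻ s, F (w, s) ∂μ ∂(Q.map W) := lintegral_prod _ hF.aemeasurable
    _ ≤ ∫⁻ _, b ∂(Q.map W) := lintegral_mono hb
    _ = b := by simp

lemma tiltedIndep_one {β : Type*} [MeasurableSpace β] {S : Ω → β}
    (hS : Measurable S) (hR : R ≤ mΩ)
    (h : Indep R (MeasurableSpace.comap S inferInstance) P) :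
    TiltedIndep P (P.map S) S R fun _ => 1 := by
  intro f hf s hs
  have hind : Measurable[MeasurableSpace.comap S inferInstance]
      ((S ⁻¹' s).indicator (1 : Ω → ℝ≥0∞)) :=
    (measurable_const : Measurable[MeasurableSpace.comap S inferInstance]
      fun _ : Ω => (1 : ℝ≥0∞)).indicator ⟨s, hs, rfl⟩
  simp only [one_mul]
  rw [lintegral_mul_eq_lintegral_mul_lintegral_of_independent_measurableSpace hR hS.comap_le h hf
    hind, lintegral_indicator_one (hS hs), Measure.map_apply hS hs, mul_comm]

end ChangeOfMeasure

/-! ### Concentration of the empirical risk -/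

section Risk

variable {Z : Type*} [MeasurableSpace Z] {D : Measure Z} {d n : ℕ}
  {ℓ : Param d → Z → ℝ} {R : ℝ≥0}

/-- The centred empirical risk `L(w, s) - 𝔼_{Z ∼ D} ℓ(w, Z)`. -/
def centeredRisk (D : Measure Z) (ℓ : Param d → Z → ℝ) (w : Param d) (s : Fin n → Z) : ℝ :=
  empRisk ℓ w s - ∫ z, ℓ w z ∂D

lemma centeredRisk_eq (hn : 0 < n) (w : Param d) (s : Fin n → Z) :
    centeredRisk D ℓ w s = (1 / (n : ℝ)) * ∑ i, (ℓ w (s i) - ∫ z, ℓ w z ∂D) := by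
  have : (n : ℝ) ≠ 0 := by positivity
  rw [centeredRisk, empRisk, Finset.sum_sub_distrib]
  simp
  field_simp

variable [IsProbabilityMeasure D]

lemma measurable_centeredRisk (hℓ : Measurable (Function.uncurry ℓ)) :
    Measurable fun p : Param d × (Fin n → Z) => centeredRisk D ℓ p.1 p.2 :=
  (measurable_empRisk hℓ measurable_fst measurable_snd).sub
    ((hℓ.stronglyMeasurable.integral_prod_right).measurable.comp measurable_fst)

/-- Averaging `n` independent `R`-sub-Gaussian terms gives the variance proxy `R² / n`. -/
lemma exists_hasSubgaussianMGF_centeredRisk (hn : 0 < n) (w : Param d)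
    (h : HasSubgaussianMGF (fun z => ℓ w z - ∫ z', ℓ w z' ∂D) (R ^ 2) D) :
    ∃ c : ℝ≥0, (c : ℝ) = R ^ 2 / n ∧ HasSubgaussianMGF (fun s : Fin n → Z => centeredRisk D ℓ w s) c
      (Measure.pi fun _ => D) := by
  have hi : ∀ i : Fin n, HasSubgaussianMGF (fun s : Fin n → Z => ℓ w (s i) - ∫ z', ℓ w z' ∂D)
      (R ^ 2) (Measure.pi fun _ => D) := fun i => by
    generalize ∫ z', ℓ w z' ∂D = c at h ⊢
    rw [← (measurePreserving_eval (fun _ : Fin n => D) i).map_eq] at h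
    exact HasSubgaussianMGF.of_map (μ := Measure.pi fun _ : Fin n => D) (Y := Function.eval i)
      (X := fun z => ℓ w z - c) (measurable_pi_apply i).aemeasurable h
  have hind : iIndepFun (fun (i : Fin n) (s : Fin n → Z) => ℓ w (s i) - ∫ z', ℓ w z' ∂D)
      (Measure.pi fun _ => D) :=
    iIndepFun_pi (X := fun _ z => ℓ w z - ∫ z', ℓ w z' ∂D) fun i => h.aemeasurable
  have hsum := (HasSubgaussianMGF.sum_of_iIndepFun hind (s := Finset.univ)
    (c := fun _ => R ^ 2) fun i _ => hi i).const_mul (1 / (n : ℝ))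
  refine ⟨_, ?_, hsum.congr (ae_of_all _ fun s => (centeredRisk_eq hn w s).symm)⟩
  have : (n : ℝ) ≠ 0 := by positivity
  change (1 / (n : ℝ)) ^ 2 * ((∑ _i : Fin n, R ^ 2 : ℝ≥0) : ℝ) = R ^ 2 / n
  simp
  field_simp

lemma integral_centeredRisk (hn : 0 < n) (w : Param d)
    (h : HasSubgaussianMGF (fun z => ℓ w z - ∫ z', ℓ w z' ∂D) (R ^ 2) D) :
    ∫ s : Fin n → Z, centeredRisk D ℓ w s ∂(Measure.pi fun _ => D) = 0 := by
  have hint : Integrable (fun z => ℓ w z) D := by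
    refine (h.integrable.add (integrable_const (∫ z', ℓ w z' ∂D))).congr (ae_of_all _ fun z => ?_)
    simp
  have hmp := fun i => measurePreserving_eval (fun _ : Fin n => D) i
  have hi : ∀ i : Fin n, Integrable (fun s : Fin n → Z => ℓ w (s i) - ∫ z', ℓ w z' ∂D)
      (Measure.pi fun _ => D) := fun i =>
    (hmp i).integrable_comp_of_integrable h.integrable
  simp_rw [centeredRisk_eq hn]
  rw [integral_const_mul, integral_finsetSum _ fun i _ => hi i]
  have : ∀ i : Fin n, ∫ s : Fin n → Z, (ℓ w (s i) - ∫ z', ℓ w z' ∂D) ∂(Measure.pi fun _ => D)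
      = 0 := fun i => by
    have h1 := integral_map (μ := Measure.pi fun _ : Fin n => D) (hmp i).measurable.aemeasurable
      (f := fun z => ℓ w z - ∫ z', ℓ w z' ∂D) (by rw [(hmp i).map_eq]; exact h.integrable.1)
    rw [(hmp i).map_eq] at h1
    rw [← h1, integral_sub hint (integrable_const _)]
    simp
  simp [this]

end Risk

/-! ### The likelihood ratio of the virtual path -/

section Likelihood

variable {Ω Z : Type*} {U mΩ : MeasurableSpace Ω} [MeasurableSpace Z] {P : Measure Ω}
  {D : Measure Z} {d n N : ℕ}
  {ℓ : Param d → Z → ℝ} {η : ℕ → ℝ} {J : ℕ → Ω → Multiset (Fin n)} {W₁ : Ω → Param d}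
  {S : Ω → Fin n → Z} {ε : ℕ → Ω → Param d} {Sg Sref : ℕ → Ω → Matrix (Fin d) (Fin d) ℝ}

/-- The mean of the reference step minus the mean of the virtual step, that is `η (G - ḡ(W̃))`: the
reference step follows the population gradient at the virtual iterate. -/
def driftGap (D : Measure Z) (ℓ : Param d → Z → ℝ) (η : ℕ → ℝ) (J : ℕ → Ω → Multiset (Fin n))
    (W₁ : Ω → Param d) (S : Ω → Fin n → Z) (ε : ℕ → Ω → Param d) (k : ℕ) (ω : Ω) : Param d :=
  η k • (stochGrad ℓ η J W₁ S k ω - popGrad D ℓ (virtualPath ℓ η J W₁ S ε k ω))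

/-- The likelihood ratio of the reference step `N(W̃ - η ḡ(W̃), Σʳᵉᶠ)` against the virtual step
`N(W̃ - η G, Σ)`, at the next virtual iterate `W̃ - η G + ε`. The arguments of the densities are the
distances of that iterate from the two means, namely `ε - driftGap` and `ε`. -/
def stepRatio (D : Measure Z) (ℓ : Param d → Z → ℝ) (η : ℕ → ℝ) (J : ℕ → Ω → Multiset (Fin n))
    (W₁ : Ω → Param d) (S : Ω → Fin n → Z) (ε : ℕ → Ω → Param d)
    (Sg Sref : ℕ → Ω → Matrix (Fin d) (Fin d) ℝ) (k : ℕ) (ω : Ω) : ℝ :=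
  gaussDensity (Sref k ω) (ε k ω - driftGap D ℓ η J W₁ S ε k ω) / gaussDensity (Sg k ω) (ε k ω)

lemma gaussDensity_nonneg (A : Matrix (Fin d) (Fin d) ℝ) (x : Param d) : 0 ≤ gaussDensity A x := by
  unfold gaussDensity
  positivity

lemma stepRatio_nonneg (k : ℕ) (ω : Ω) : 0 ≤ stepRatio D ℓ η J W₁ S ε Sg Sref k ω :=
  div_nonneg (gaussDensity_nonneg _ _) (gaussDensity_nonneg _ _)

variable [IsProbabilityMeasure D]

lemma measurable_driftGap_noiseHistory (hℓ : Measurable (Function.uncurry ℓ))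
    (hdiff : ∀ z, Differentiable ℝ fun w => ℓ w z) {k : ℕ} (hk : k < N) :
    Measurable[noiseHistory U ℓ η J W₁ S N ε k] (driftGap D ℓ η J W₁ S ε k) := by
  have h1 : Measurable[noiseHistory U ℓ η J W₁ S N ε k] (stochGrad ℓ η J W₁ S k) :=
    (measurable_stochGrad_history hk).mono
      (le_sup_left.trans (history_sup_comap_le_noiseHistory k)) le_rfl
  have h2 := (measurable_popGrad (D := D) hℓ hdiff).comp
    (measurable_virtualPath_noiseHistory (U := U) (ℓ := ℓ) (η := η) (J := J) (W₁ := W₁) (S := S)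
      (ε := ε) hk.le)
  exact (h1.sub h2).const_smul (η k)

lemma measurable_stepRatio (hℓ : Measurable (Function.uncurry ℓ))
    (hdiff : ∀ z, Differentiable ℝ fun w => ℓ w z) {k : ℕ} (hk : k < N)
    (hSg : IsPredictableCov P (history ℓ η J W₁ S) N Sg)
    (hSref : ∀ k < N, IsAdmissibleRef P (refVisible U ℓ η J W₁ S ε k) (Sref k)) :
    Measurable[noiseHistory U ℓ η J W₁ S N ε (k + 1)] (stepRatio D ℓ η J W₁ S ε Sg Sref k) := by
  have hmono := noiseHistory_mono (U := U) (ℓ := ℓ) (η := η) (J := J) (W₁ := W₁) (S := S) (N := N)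
      (ε := ε) k.le_succ
  have hε := measurable_noise_noiseHistory (U := U) (ℓ := ℓ) (η := η) (J := J) (W₁ := W₁) (S := S)
      (N := N) (ε := ε) k.lt_succ_self
  have hA : MatrixMeasurable (noiseHistory U ℓ η J W₁ S N ε (k + 1)) (Sg k) := fun i j =>
    (hSg.measurable k hk i j).mono ((history_mono hk.le).trans
      (le_sup_left.trans (history_sup_comap_le_noiseHistory _))) le_rfl
  have hB : MatrixMeasurable (noiseHistory U ℓ η J W₁ S N ε (k + 1)) (Sref k) := fun i j =>
    ((hSref k hk).measurable i j).mono ((refVisible_le_noiseHistory hk.le).trans hmono) le_rfl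
  exact (hB.measurable_gaussDensity (hε.sub
    ((measurable_driftGap_noiseHistory hℓ hdiff hk).mono hmono le_rfl))).div
      (hA.measurable_gaussDensity hε)

/-- The drift gap is controlled, in the reference norm, by the gradient deviation and the gradient
sensitivity in the norm of the actual covariance. -/
lemma integral_sqNorm_driftGap_le (hℓ : Measurable (Function.uncurry ℓ))
    (hdiff : ∀ z, Differentiable ℝ fun w => ℓ w z) {k : ℕ} (hk : k < N)
    (hm : noiseHistory U ℓ η J W₁ S N ε k ≤ mΩ)
    (hSg : IsPredictableCov P (history ℓ η J W₁ S) N Sg)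
    (hSref : ∀ k < N, IsAdmissibleRef P (refVisible U ℓ η J W₁ S ε k) (Sref k))
    (hV : Integrable (fun ω => sqNorm (Sg k ω)⁻¹
      (stochGrad ℓ η J W₁ S k ω - popGrad D ℓ (sgd ℓ η J W₁ S k ω))) P)
    (hΓ : Integrable (fun ω => sqNorm (Sg k ω)⁻¹
      (popGrad D ℓ (sgd ℓ η J W₁ S k ω + accNoise ℓ η J W₁ S ε k ω)
        - popGrad D ℓ (sgd ℓ η J W₁ S k ω))) P)
    {κ : ℝ} (hκ : 0 ≤ κ) (h_comp : ∀ᵐ ω ∂P, (κ • (Sg k ω)⁻¹ - (Sref k ω)⁻¹).PosSemidef) :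
    Integrable (fun ω => sqNorm (Sref k ω)⁻¹ (driftGap D ℓ η J W₁ S ε k ω)) P ∧
      ∫ ω, sqNorm (Sref k ω)⁻¹ (driftGap D ℓ η J W₁ S ε k ω) ∂P
        ≤ 2 * κ * (η k ^ 2 * (∫ ω, sqNorm (Sg k ω)⁻¹
            (stochGrad ℓ η J W₁ S k ω - popGrad D ℓ (sgd ℓ η J W₁ S k ω)) ∂P
          + ∫ ω, sqNorm (Sg k ω)⁻¹
            (popGrad D ℓ (sgd ℓ η J W₁ S k ω + accNoise ℓ η J W₁ S ε k ω)
              - popGrad D ℓ (sgd ℓ η J W₁ S k ω)) ∂P)) := by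
  have hbd : ∀ᵐ ω ∂P, sqNorm (Sref k ω)⁻¹ (driftGap D ℓ η J W₁ S ε k ω)
      ≤ 2 * κ * (η k ^ 2 * (sqNorm (Sg k ω)⁻¹
            (stochGrad ℓ η J W₁ S k ω - popGrad D ℓ (sgd ℓ η J W₁ S k ω))
          + sqNorm (Sg k ω)⁻¹
            (popGrad D ℓ (sgd ℓ η J W₁ S k ω + accNoise ℓ η J W₁ S ε k ω)
              - popGrad D ℓ (sgd ℓ η J W₁ S k ω)))) := by
    filter_upwards [hSg.posDef k hk, h_comp] with ω hA hc
    -- both gradients are compared with the population gradient at the true iterate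
    have hWξ : sgd ℓ η J W₁ S k ω + accNoise ℓ η J W₁ S ε k ω = virtualPath ℓ η J W₁ S ε k ω := by
      rw [accNoise]
      abel
    have h1 := sqNorm_le_sqNorm hc (driftGap D ℓ η J W₁ S ε k ω)
    have h2 := sqNorm_sub_le hA.inv.posSemidef
      (stochGrad ℓ η J W₁ S k ω - popGrad D ℓ (sgd ℓ η J W₁ S k ω))
      (popGrad D ℓ (virtualPath ℓ η J W₁ S ε k ω) - popGrad D ℓ (sgd ℓ η J W₁ S k ω))
    rw [sub_sub_sub_cancel_right] at h2
    rw [sqNorm_smul_left, driftGap, sqNorm_smul_right (η k) (Sg k ω)⁻¹] at h1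
    rw [hWξ]
    refine h1.trans ?_
    have h3 := mul_le_mul_of_nonneg_left h2 (mul_nonneg hκ (sq_nonneg (η k)))
    linarith
  have hint := ((hV.add hΓ).const_mul (η k ^ 2)).const_mul (2 * κ)
  have hmeas : Measurable fun ω => sqNorm (Sref k ω)⁻¹ (driftGap D ℓ η J W₁ S ε k ω) := by
    have hB : MatrixMeasurable mΩ (Sref k) := fun i j =>
      ((hSref k hk).measurable i j).mono ((refVisible_le_noiseHistory hk.le).trans hm) le_rfl
    exact hB.inv.measurable_sqNorm ((measurable_driftGap_noiseHistory hℓ hdiff hk).mono hm le_rfl)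
  have hi : Integrable (fun ω => sqNorm (Sref k ω)⁻¹ (driftGap D ℓ η J W₁ S ε k ω)) P := by
    refine hint.mono' hmeas.aestronglyMeasurable ?_
    filter_upwards [hbd, (hSref k hk).posDef] with ω h hB
    rw [Real.norm_of_nonneg (sqNorm_nonneg hB.inv.posSemidef _)]
    exact h
  refine ⟨hi, (integral_mono_ae hi hint hbd).trans_eq ?_⟩
  rw [integral_const_mul, integral_const_mul, ← integral_add hV hΓ]
  rfl

variable [IsProbabilityMeasure P]

/-- The product of the likelihood ratios is a probability density under which the sample keeps its
law and is independent of the virtual path and of the auxiliary randomness. -/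
lemma tiltedIndep_prod_stepRatio (hℓ : Measurable (Function.uncurry ℓ))
    (hdiff : ∀ z, Differentiable ℝ fun w => ℓ w z) (hS : Measurable S)
    (hS_law : P.map S = Measure.pi fun _ => D) (hW₁ : Measurable W₁) (hU : U ≤ mΩ)
    (hJ : ∀ k < N, Measurable[mΩ, ⊤] (J k))
    (h_indep : Indep (MeasurableSpace.comap W₁ inferInstance ⊔ U)
      (MeasurableSpace.comap S inferInstance) P)
    (hSg : IsPredictableCov P (history ℓ η J W₁ S) N Sg)
    (hε_meas : ∀ k < N, Measurable (ε k))
    (hε : IsVirtualNoise U P ℓ η J W₁ S N Sg ε)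
    (hSref : ∀ k < N, IsAdmissibleRef P (refVisible U ℓ η J W₁ S ε k) (Sref k)) :
    ∀ k ≤ N,
      TiltedIndep P (Measure.pi fun _ => D) S (refVisible U ℓ η J W₁ S ε k)
        (fun ω => ENNReal.ofReal (∏ j ∈ Finset.range k, stepRatio D ℓ η J W₁ S ε Sg Sref j ω)) ∧
      ∫⁻ ω, ENNReal.ofReal (∏ j ∈ Finset.range k, stepRatio D ℓ η J W₁ S ε Sg Sref j ω) ∂P = 1 := by
  intro k
  induction k with
  | zero =>
    intro _
    have href : refVisible U ℓ η J W₁ S ε 0 = MeasurableSpace.comap W₁ inferInstance ⊔ U := by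
      simp [refVisible]
      rfl
    have h0 := tiltedIndep_one hS (sup_le hW₁.comap_le hU) h_indep
    rw [hS_law] at h0
    rw [href]
    simpa using h0
  | succ k ih =>
    intro hk
    obtain ⟨ihT, ih1⟩ := ih (by omega)
    have hk' : k < N := hk
    have hH : history ℓ η J W₁ S N ≤ mΩ := history_le hℓ hdiff hS hW₁ hJ le_rfl
    have hm : noiseHistory U ℓ η J W₁ S N ε k ≤ mΩ := noiseHistory_le hH hS hU hε_meas hk'.le
    have hHm : history ℓ η J W₁ S N ≤ noiseHistory U ℓ η J W₁ S N ε k :=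
      le_sup_left.trans (history_sup_comap_le_noiseHistory _)
    have hA : MatrixMeasurable (noiseHistory U ℓ η J W₁ S N ε k) (Sg k) := fun i j =>
      (hSg.measurable k hk' i j).mono ((history_mono hk'.le).trans hHm) le_rfl
    have hv : Measurable[noiseHistory U ℓ η J W₁ S N ε k]
        (fun ω => virtualPath ℓ η J W₁ S ε k ω - η k • stochGrad ℓ η J W₁ S k ω) :=
      (measurable_virtualPath_noiseHistory hk'.le).sub
        (((measurable_stochGrad_history hk').mono hHm le_rfl).const_smul (η k))
    have hu : Measurable[refVisible U ℓ η J W₁ S ε k] (fun ω => virtualPath ℓ η J W₁ S ε k ω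
        - η k • popGrad D ℓ (virtualPath ℓ η J W₁ S ε k ω)) :=
      (measurable_virtualPath_refVisible k).sub
        (((measurable_popGrad hℓ hdiff).comp (measurable_virtualPath_refVisible k)).const_smul
          (η k))
    have hM : Measurable[noiseHistory U ℓ η J W₁ S N ε k] (fun ω => ENNReal.ofReal
        (∏ j ∈ Finset.range k, stepRatio D ℓ η J W₁ S ε Sg Sref j ω)) := by
      refine (Finset.measurable_prod _ fun j hj => ?_).ennreal_ofReal
      have hj' := Finset.mem_range.1 hj
      exact (measurable_stepRatio hℓ hdiff (by omega) hSg hSref).mono (noiseHistory_mono hj') le_rfl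
    have hstep := ihT.step (refVisible_le_noiseHistory hk'.le) hm (measurable_sample_noiseHistory k)
      (hε_meas k hk') hA (hSg.posDef k hk') (hSref k hk').measurable (hSref k hk').posDef
      (hε k hk') hv hu hM
    have heq : ∀ ω, virtualPath ℓ η J W₁ S ε k ω - η k • stochGrad ℓ η J W₁ S k ω + ε k ω
        - (virtualPath ℓ η J W₁ S ε k ω - η k • popGrad D ℓ (virtualPath ℓ η J W₁ S ε k ω))
        = ε k ω - driftGap D ℓ η J W₁ S ε k ω := fun ω => by
      rw [driftGap, smul_sub]
      abel
    have hprod : ∀ ω, ENNReal.ofReal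
        (∏ j ∈ Finset.range (k + 1), stepRatio D ℓ η J W₁ S ε Sg Sref j ω)
        = ENNReal.ofReal (∏ j ∈ Finset.range k, stepRatio D ℓ η J W₁ S ε Sg Sref j ω)
          * ENNReal.ofReal (gaussDensity (Sref k ω) (ε k ω - driftGap D ℓ η J W₁ S ε k ω)
            / gaussDensity (Sg k ω) (ε k ω)) := fun ω => by
      rw [Finset.prod_range_succ, ENNReal.ofReal_mul
        (Finset.prod_nonneg fun j _ => stepRatio_nonneg j ω), stepRatio]
    simp only [heq] at hstep
    simp only [hprod]
    rw [refVisible_succ]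
    exact ⟨hstep.1, hstep.2.trans ih1⟩

/-- The entropy cost of the whole change of measure, bounded by the bracket of the generalization
bound. Positivity and integrability are part of the conclusion. -/
lemma integral_neg_log_prod_stepRatio_le (hℓ : Measurable (Function.uncurry ℓ))
    (hdiff : ∀ z, Differentiable ℝ fun w => ℓ w z) (hS : Measurable S) (hW₁ : Measurable W₁)
    (hU : U ≤ mΩ) (hJ : ∀ k < N, Measurable[mΩ, ⊤] (J k))
    (hSg : IsPredictableCov P (history ℓ η J W₁ S) N Sg)
    (hε_meas : ∀ k < N, Measurable (ε k))
    (hε : IsVirtualNoise U P ℓ η J W₁ S N Sg ε)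
    (hSref : ∀ k < N, IsAdmissibleRef P (refVisible U ℓ η J W₁ S ε k) (Sref k))
    (hV : ∀ k < N, Integrable (fun ω => sqNorm (Sg k ω)⁻¹
      (stochGrad ℓ η J W₁ S k ω - popGrad D ℓ (sgd ℓ η J W₁ S k ω))) P)
    (hΓ : ∀ k < N, Integrable (fun ω => sqNorm (Sg k ω)⁻¹
      (popGrad D ℓ (sgd ℓ η J W₁ S k ω + accNoise ℓ η J W₁ S ε k ω)
        - popGrad D ℓ (sgd ℓ η J W₁ S k ω))) P)
    (hC : ∀ k < N, Integrable (fun ω => covMismatch (Sg k ω) (Sref k ω)) P)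
    {κ : ℝ} (hκ : 0 ≤ κ)
    (h_comp : ∀ k < N, ∀ᵐ ω ∂P, (κ • (Sg k ω)⁻¹ - (Sref k ω)⁻¹).PosSemidef) :
    (∀ᵐ ω ∂P, 0 < ∏ j ∈ Finset.range N, stepRatio D ℓ η J W₁ S ε Sg Sref j ω) ∧
    Integrable (fun ω => -log (∏ j ∈ Finset.range N, stepRatio D ℓ η J W₁ S ε Sg Sref j ω)) P ∧
      ∫ ω, -log (∏ j ∈ Finset.range N, stepRatio D ℓ η J W₁ S ε Sg Sref j ω) ∂P
        ≤ 2 * κ * ∑ k ∈ Finset.range N, η k ^ 2 *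
              ∫ ω, (gradDeviation U P D ℓ η J W₁ S (fun ω => (Sg k ω)⁻¹) k ω
                + gradSensitivity U P D ℓ η J W₁ S ε (fun ω => (Sg k ω)⁻¹) k ω) ∂P
            + ∑ k ∈ Finset.range N, covCost P (Sg k) (Sref k) := by
  have hHle := fun {r : ℕ} (hr : r ≤ N) => history_le (η := η) hℓ hdiff hS hW₁ hJ hr
  have hm : ∀ k ≤ N, noiseHistory U ℓ η J W₁ S N ε k ≤ mΩ := fun k hk =>
    noiseHistory_le (hHle le_rfl) hS hU hε_meas hk
  have hpos : ∀ k < N, ∀ᵐ ω ∂P, 0 < stepRatio D ℓ η J W₁ S ε Sg Sref k ω := fun k hk => by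
    filter_upwards [hSg.posDef k hk, (hSref k hk).posDef] with ω hA hB
    exact div_pos (gaussDensity_pos hB _) (gaussDensity_pos hA _)
  have hpos' : ∀ᵐ ω ∂P, ∀ k ∈ Finset.range N, 0 < stepRatio D ℓ η J W₁ S ε Sg Sref k ω :=
    (Filter.eventually_all_finset _).2 fun k hk => hpos k (Finset.mem_range.1 hk)
  have hdrift := fun k (hk : k < N) => integral_sqNorm_driftGap_le hℓ hdiff hk (hm k hk.le)
    hSg hSref (hV k hk) (hΓ k hk) hκ (h_comp k hk)
  have hstep : ∀ k < N, Integrable (fun ω => -log (stepRatio D ℓ η J W₁ S ε Sg Sref k ω)) P ∧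
      ∫ ω, -log (stepRatio D ℓ η J W₁ S ε Sg Sref k ω) ∂P
        = covCost P (Sg k) (Sref k)
          + (1 / 2) * ∫ ω, sqNorm (Sref k ω)⁻¹ (driftGap D ℓ η J W₁ S ε k ω) ∂P := by
    intro k hk
    have hA : MatrixMeasurable (noiseHistory U ℓ η J W₁ S N ε k) (Sg k) := fun i j =>
      (hSg.measurable k hk i j).mono ((history_mono hk.le).trans
        (le_sup_left.trans (history_sup_comap_le_noiseHistory _))) le_rfl
    have hB : MatrixMeasurable (noiseHistory U ℓ η J W₁ S N ε k) (Sref k) := fun i j =>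
      ((hSref k hk).measurable i j).mono (refVisible_le_noiseHistory hk.le) le_rfl
    exact (hε k hk).integral_neg_log_likelihoodRatio (hm k hk.le) (hε_meas k hk) hA
      (hSg.posDef k hk) hB (hSref k hk).posDef (measurable_driftGap_noiseHistory hℓ hdiff hk)
      (h_comp k hk) (hC k hk) (hdrift k hk).1
  have hlog : (fun ω => -log (∏ j ∈ Finset.range N, stepRatio D ℓ η J W₁ S ε Sg Sref j ω))
      =ᵐ[P] fun ω => ∑ j ∈ Finset.range N, -log (stepRatio D ℓ η J W₁ S ε Sg Sref j ω) := by
    filter_upwards [hpos'] with ω hω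
    rw [log_prod fun j hj => (hω j hj).ne', Finset.sum_neg_distrib]
  have hsum := integrable_finsetSum (Finset.range N) fun k hk => (hstep k (Finset.mem_range.1 hk)).1
  refine ⟨hpos'.mono fun ω hω => Finset.prod_pos hω, hsum.congr hlog.symm, ?_⟩
  rw [integral_congr_ae hlog,
    integral_finsetSum _ fun k hk => (hstep k (Finset.mem_range.1 hk)).1, Finset.mul_sum,
    ← Finset.sum_add_distrib]
  refine Finset.sum_le_sum fun k hk => ?_
  have hk' := Finset.mem_range.1 hk
  have hcond : history ℓ η J W₁ S k ⊔ U ≤ mΩ := sup_le (hHle hk'.le) hU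
  have hVΓ : ∫ ω, (gradDeviation U P D ℓ η J W₁ S (fun ω => (Sg k ω)⁻¹) k ω
      + gradSensitivity U P D ℓ η J W₁ S ε (fun ω => (Sg k ω)⁻¹) k ω) ∂P
      = ∫ ω, sqNorm (Sg k ω)⁻¹
            (stochGrad ℓ η J W₁ S k ω - popGrad D ℓ (sgd ℓ η J W₁ S k ω)) ∂P
          + ∫ ω, sqNorm (Sg k ω)⁻¹
            (popGrad D ℓ (sgd ℓ η J W₁ S k ω + accNoise ℓ η J W₁ S ε k ω)
              - popGrad D ℓ (sgd ℓ η J W₁ S k ω)) ∂P := by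
    rw [gradDeviation, gradSensitivity, integral_add integrable_condExp integrable_condExp,
      integral_condExp hcond, integral_condExp hcond]
  rw [(hstep k hk').2, hVΓ]
  have h0 : 0 ≤ ∫ ω, sqNorm (Sref k ω)⁻¹ (driftGap D ℓ η J W₁ S ε k ω) ∂P :=
    integral_nonneg_of_ae ((hSref k hk').posDef.mono fun ω hB =>
      sqNorm_nonneg hB.inv.posSemidef _)
  -- the exact cost carries a factor `1 / 2` on the drift term; the stated bound does without it
  linarith [(hdrift k hk').2]

end Likelihood

/-! ### Averaging over the ghost sample and fresh noise -/

section FreshNoise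

variable {Ω α β E : Type*} {mα : MeasurableSpace α} [MeasurableSpace β] [MeasurableSpace E]
  [mΩ : MeasurableSpace Ω] {P : Measure Ω} [IsProbabilityMeasure P]

/-- Suppose that `H` is centred in its last argument under the law of the ghost sample `S'`, and
that `S'` is independent of `Y`. Then averaging `H` over noise drawn afresh from the kernel `κ`, the
difference between the ghost sample and a sample `s(Y)` reduces to the latter, and the fresh noise
may be replaced by any `X` with conditional law `κ` given `Y`. Freshness matters for the ghost term,
as nothing is assumed about the joint law of `X` and `S'`. -/
lemma integral_kernel_ghost_sub {Y : Ω → α} (hY : Measurable Y) {X : Ω → E} (hX : Measurable X)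
    {κ : Kernel α E} [IsMarkovKernel κ] (hXY : P.map (fun ω => (Y ω, X ω)) = P.map Y ⊗ₘ κ)
    {S' : Ω → β} (hS' : Measurable S') {ν : Measure β} [IsProbabilityMeasure ν]
    (hYS' : P.map (fun ω => (Y ω, S' ω)) = (P.map Y).prod ν)
    {s : α → β} (hs : Measurable s) {H : (α × E) × β → ℝ} (hH : Measurable H)
    (hint : Integrable (fun ω => H ((Y ω, X ω), s (Y ω))) P)
    {b : ℝ≥0∞} (hb : b ≠ ∞) (hbd : ∀ p, ∫⁻ s', ‖H (p, s')‖ₑ ∂ν ≤ b)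
    (hzero : ∀ p, ∫ s', H (p, s') ∂ν = 0) :
    ∫ ω, ∫ ζ, (H ((Y ω, ζ), S' ω) - H ((Y ω, ζ), s (Y ω))) ∂(κ (Y ω)) ∂P
      = -∫ ω, H ((Y ω, X ω), s (Y ω)) ∂P := by
  have : IsProbabilityMeasure (P.map Y) := Measure.isProbabilityMeasure_map hY.aemeasurable
  have hYX : Measurable fun ω => (Y ω, X ω) := hY.prodMk hX
  have hYS : Measurable fun ω => (Y ω, S' ω) := hY.prodMk hS'
  -- the term of the true sample
  have hH1 : Measurable fun p : α × E => H (p, s p.1) :=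
    hH.comp (measurable_id.prodMk (hs.comp measurable_fst))
  have hi1 : Integrable (fun p : α × E => H (p, s p.1)) (P.map Y ⊗ₘ κ) := by
    rw [← hXY]
    exact (integrable_map_measure hH1.aestronglyMeasurable hYX.aemeasurable).2 hint
  have hm1 : StronglyMeasurable fun a => ∫ ζ, H ((a, ζ), s a) ∂(κ a) :=
    hH1.stronglyMeasurable.integral_kernel_prod_right'
  have e1 : ∫ ω, H ((Y ω, X ω), s (Y ω)) ∂P = ∫ ω, ∫ ζ, H ((Y ω, ζ), s (Y ω)) ∂(κ (Y ω)) ∂P := by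
    rw [← integral_map (f := fun a => ∫ ζ, H ((a, ζ), s a) ∂(κ a)) hY.aemeasurable
      hm1.aestronglyMeasurable, ← Measure.integral_compProd hi1, ← hXY,
      integral_map hYX.aemeasurable hH1.aestronglyMeasurable]
  have i1 : Integrable (fun ω => ∫ ζ, H ((Y ω, ζ), s (Y ω)) ∂(κ (Y ω))) P :=
    (integrable_map_measure hm1.aestronglyMeasurable hY.aemeasurable).1 hi1.integral_compProd
  have a1 : ∀ᵐ ω ∂P, Integrable (fun ζ => H ((Y ω, ζ), s (Y ω))) (κ (Y ω)) :=
    ae_of_ae_map hY.aemeasurable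
      ((Measure.integrable_compProd_iff hH1.aestronglyMeasurable).1 hi1).1
  -- the term of the ghost sample
  let κ' : Kernel (α × β) E := κ.comap Prod.fst measurable_fst
  have hH2 : Measurable fun q : (α × β) × E => H ((q.1.1, q.2), q.1.2) := by fun_prop
  have hswap : ∀ a, ∫⁻ s', ∫⁻ ζ, ‖H ((a, ζ), s')‖ₑ ∂(κ a) ∂ν ≤ b := fun a => by
    have hm : Measurable fun q : β × E => ‖H ((a, q.2), q.1)‖ₑ :=
      (hH.comp ((measurable_const.prodMk measurable_snd).prodMk measurable_fst)).enorm
    rw [lintegral_lintegral_swap hm.aemeasurable]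
    calc _ ≤ ∫⁻ _, b ∂(κ a) := lintegral_mono fun ζ => hbd (a, ζ)
      _ = b := by simp
  have hi2 : Integrable (fun q : (α × β) × E => H ((q.1.1, q.2), q.1.2))
      ((P.map Y).prod ν ⊗ₘ κ') := by
    refine ⟨hH2.aestronglyMeasurable, ?_⟩
    rw [HasFiniteIntegral, Measure.lintegral_compProd hH2.enorm, lintegral_prod _
      (Measurable.lintegral_kernel_prod_right' hH2.enorm).aemeasurable]
    refine lt_of_le_of_lt ?_ hb.lt_top
    calc _ ≤ ∫⁻ _, b ∂(P.map Y) := lintegral_mono fun a => hswap a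
      _ = b := by simp
  have hm2 : StronglyMeasurable fun p : α × β => ∫ ζ, H ((p.1, ζ), p.2) ∂(κ' p) :=
    hH2.stronglyMeasurable.integral_kernel_prod_right'
  have i2' : Integrable (fun p : α × β => ∫ ζ, H ((p.1, ζ), p.2) ∂(κ' p)) ((P.map Y).prod ν) :=
    hi2.integral_compProd
  have i2 : Integrable (fun ω => ∫ ζ, H ((Y ω, ζ), S' ω) ∂(κ (Y ω))) P := by
    rw [← hYS'] at i2'
    exact (integrable_map_measure hm2.aestronglyMeasurable hYS.aemeasurable).1 i2'
  have a2 : ∀ᵐ ω ∂P, Integrable (fun ζ => H ((Y ω, ζ), S' ω)) (κ (Y ω)) := by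
    have := ((Measure.integrable_compProd_iff hH2.aestronglyMeasurable).1 hi2).1
    rw [← hYS'] at this
    exact ae_of_ae_map hYS.aemeasurable this
  have e2 : ∫ ω, ∫ ζ, H ((Y ω, ζ), S' ω) ∂(κ (Y ω)) ∂P = 0 := by
    have h1 := integral_map (μ := P) hYS.aemeasurable
      (f := fun p : α × β => ∫ ζ, H ((p.1, ζ), p.2) ∂(κ' p)) hm2.aestronglyMeasurable
    refine h1.symm.trans ?_
    rw [hYS', integral_prod _ i2']
    refine integral_eq_zero_of_ae (ae_of_all _ fun a => ?_)
    have hm : Measurable fun q : β × E => H ((a, q.2), q.1) :=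
      hH.comp ((measurable_const.prodMk measurable_snd).prodMk measurable_fst)
    have hia : Integrable (Function.uncurry fun s' ζ => H ((a, ζ), s')) (ν.prod (κ a)) := by
      refine ⟨hm.aestronglyMeasurable, ?_⟩
      exact (lintegral_prod _ hm.enorm.aemeasurable).trans_lt ((hswap a).trans_lt hb.lt_top)
    exact (integral_integral_swap hia).trans (by simp [hzero])
  rw [e1, integral_congr_ae (g := fun ω => ∫ ζ, H ((Y ω, ζ), S' ω) ∂(κ (Y ω))
    - ∫ ζ, H ((Y ω, ζ), s (Y ω)) ∂(κ (Y ω))), integral_sub i2 i1, e2, zero_sub]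
  filter_upwards [a1, a2] with ω h1 h2
  exact integral_sub h2 h1

lemma map_prodMk_eq_prod_of_indep {Y : Ω → α} (hY : Measurable Y) {X : Ω → β} (hX : Measurable X)
    (h : Indep (MeasurableSpace.comap X inferInstance) (mα.comap Y) P) :
    P.map (fun ω => (Y ω, X ω)) = (P.map Y).prod (P.map X) :=
  (indepFun_iff_map_prod_eq_prod_map_map hY.aemeasurable hX.aemeasurable).1 h.symm

end FreshNoise

/-! ### The law of the accumulated noise -/

section AccumulatedNoise

variable {Ω Z : Type*} {U m mΩ : MeasurableSpace Ω} [MeasurableSpace Z] {P : Measure Ω}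
  {D : Measure Z} {d n N : ℕ}
  {ℓ : Param d → Z → ℝ} {η : ℕ → ℝ} {J : ℕ → Ω → Multiset (Fin n)} {W₁ : Ω → Param d}
  {S : Ω → Fin n → Z} {ε : ℕ → Ω → Param d} {Sg : ℕ → Ω → Matrix (Fin d) (Fin d) ℝ}

lemma IsPredictableCov.accCov_posSemidef {H : ℕ → MeasurableSpace Ω}
    (hSg : IsPredictableCov P H N Sg) {k : ℕ} (hk : k ≤ N) :
    ∀ᵐ ω ∂P, (accCov Sg k ω).PosSemidef := by
  have : ∀ᵐ ω ∂P, ∀ j ∈ Finset.range k, (Sg j ω).PosDef :=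
    (Filter.eventually_all_finset _).2 fun j hj => hSg.posDef j (by
      have := Finset.mem_range.1 hj; omega)
  filter_upwards [this] with ω hω
  exact Matrix.posSemidef_sum _ fun j hj => (hω j hj).posSemidef

lemma IsPredictableCov.accCov_posDef {H : ℕ → MeasurableSpace Ω}
    (hSg : IsPredictableCov P H N Sg) (hN : 0 < N) : ∀ᵐ ω ∂P, (accCov Sg N ω).PosDef := by
  obtain ⟨k, rfl⟩ : ∃ k, N = k + 1 := ⟨N - 1, by omega⟩
  filter_upwards [hSg.accCov_posSemidef k.le_succ, hSg.posDef k k.lt_succ_self] with ω h1 h2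
  rw [accCov, Finset.sum_range_succ]
  exact h2.posSemidef_add h1

lemma IsPredictableCov.measurable_accCov {H : ℕ → MeasurableSpace Ω}
    (hSg : IsPredictableCov P H N Sg) (hm : ∀ k < N, H k ≤ m) :
    MatrixMeasurable m (accCov Sg N) := fun i j => by
  simp only [accCov, Matrix.sum_apply]
  exact Finset.measurable_sum _ fun k hk =>
    (hSg.measurable k (Finset.mem_range.1 hk) i j).mono (hm k (Finset.mem_range.1 hk)) le_rfl

/-- Given `m`, the sum of the first `k` perturbations is Gaussian with the accumulated covariance:
the last perturbation is integrated out first, and Gaussian laws convolve by adding covariances. -/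
lemma lintegral_sum_noise [IsProbabilityMeasure P] (hℓ : Measurable (Function.uncurry ℓ))
    (hdiff : ∀ z, Differentiable ℝ fun w => ℓ w z) (hS : Measurable S) (hW₁ : Measurable W₁)
    (hU : U ≤ mΩ) (hJ : ∀ k < N, Measurable[mΩ, ⊤] (J k))
    (hSg : IsPredictableCov P (history ℓ η J W₁ S) N Sg)
    (hε_meas : ∀ k < N, Measurable (ε k))
    (hε : IsVirtualNoise U P ℓ η J W₁ S N Sg ε) (hHm : history ℓ η J W₁ S N ≤ m)
    (hmle : m ≤ history ℓ η J W₁ S N ⊔ MeasurableSpace.comap S inferInstance)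
    {k : ℕ} (hk : k ≤ N)
    {F : Ω × Param d → ℝ≥0∞} (hF : @Measurable _ _ (m.prod inferInstance) _ F) :
    ∫⁻ ω, F (ω, ∑ j ∈ Finset.range k, ε j ω) ∂P
      = ∫⁻ ω, ∫⁻ x, F (ω, x) ∂(multivariateGaussian 0 (accCov Sg k ω)) ∂P := by
  induction k generalizing F with
  | zero =>
    have h0 : ∀ ω, accCov Sg 0 ω = 0 := fun ω => by simp [accCov]
    refine lintegral_congr fun ω => ?_
    have hFs : Measurable fun x => F (ω, x) := hF.comp (@measurable_prodMk_left _ _ m _ ω)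
    rw [h0, multivariateGaussian_zero_zero, lintegral_dirac' _ hFs]
    simp
  | succ k ih =>
    have hk' : k < N := hk
    have hm' : noiseHistory U ℓ η J W₁ S N ε k ≤ mΩ :=
      noiseHistory_le (history_le hℓ hdiff hS hW₁ hJ le_rfl) hS hU hε_meas hk'.le
    have hle : m ≤ noiseHistory U ℓ η J W₁ S N ε k :=
      hmle.trans (history_sup_comap_le_noiseHistory k)
    have hA : MatrixMeasurable m (Sg k) := fun i j =>
      (hSg.measurable k hk' i j).mono ((history_mono hk'.le).trans hHm) le_rfl
    have hA' : MatrixMeasurable (noiseHistory U ℓ η J W₁ S N ε k) (Sg k) := fun i j =>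
      (hA i j).mono hle le_rfl
    have hsum : Measurable[noiseHistory U ℓ η J W₁ S N ε k]
        fun ω => ∑ j ∈ Finset.range k, ε j ω :=
      Finset.measurable_sum _ fun j hj => measurable_noise_noiseHistory (Finset.mem_range.1 hj)
    have hF' : @Measurable _ _ ((noiseHistory U ℓ η J W₁ S N ε k).prod inferInstance) _ F :=
      hF.mono (sup_le_sup (MeasurableSpace.comap_mono hle) le_rfl) le_rfl
    have s1 := (hε k hk').lintegral_prodMk hm' (hε_meas k hk') hA' (hSg.posDef k hk')
      (F := fun p => F (p.1, ∑ j ∈ Finset.range k, ε j p.1 + p.2))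
      (hF'.comp (measurable_fst.prodMk ((hsum.comp measurable_fst).add measurable_snd)))
    -- the kernel version of the inner integral is jointly measurable, as the induction requires
    let G : Ω × Param d → ℝ≥0∞ := fun p => ∫⁻ x, F (p.1, p.2 + x) ∂(gaussKernel hA p.1)
    have hG : @Measurable _ _ (m.prod inferInstance) _ G := by
      refine Measurable.lintegral_kernel_prod_right' (κ := (gaussKernel hA).comap Prod.fst
        measurable_fst) (f := fun q : (Ω × Param d) × Param d => F (q.1.1, q.1.2 + q.2)) ?_
      exact hF.comp ((measurable_fst.comp measurable_fst).prodMk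
        ((measurable_snd.comp measurable_fst).add measurable_snd))
    have hGae : ∀ᵐ ω ∂P, ∀ y, G (ω, y)
        = ∫⁻ x, F (ω, y + x) ∂(multivariateGaussian 0 (Sg k ω)) := by
      filter_upwards [hSg.posDef k hk'] with ω hω y
      simp only [G, gaussKernel_of_posDef hA hω]
    simp only [Finset.sum_range_succ]
    refine s1.trans ?_
    simp only
    rw [lintegral_congr_ae (g := fun ω => G (ω, ∑ j ∈ Finset.range k, ε j ω))
      (hGae.mono fun ω hω => (hω _).symm), ih hk'.le hG]
    refine lintegral_congr_ae ?_
    filter_upwards [hGae, hSg.accCov_posSemidef hk'.le, hSg.posDef k hk'] with ω h1 h2 h3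
    have hFs : Measurable fun x => F (ω, x) := hF.comp (@measurable_prodMk_left _ _ m _ ω)
    have hacc : accCov Sg (k + 1) ω = accCov Sg k ω + Sg k ω := by
      simp [accCov, Finset.sum_range_succ]
    rw [hacc, ← multivariateGaussian_conv h2 h3.posSemidef,
      Measure.lintegral_conv hFs]
    exact lintegral_congr fun y => h1 y

end AccumulatedNoise

/-! ### The generalization error -/

section Risk

variable {Z : Type*} [MeasurableSpace Z] {D : Measure Z} [IsProbabilityMeasure D] {d n : ℕ}
  {ℓ : Param d → Z → ℝ} {R : ℝ≥0}

lemma lintegral_exp_centeredRisk_le (hn : 0 < n) (w : Param d)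
    (h : HasSubgaussianMGF (fun z => ℓ w z - ∫ z', ℓ w z' ∂D) (R ^ 2) D) (t : ℝ) :
    ∫⁻ s : Fin n → Z, ENNReal.ofReal (exp (t * centeredRisk D ℓ w s)) ∂(Measure.pi fun _ => D)
      ≤ ENNReal.ofReal (exp ((R : ℝ) ^ 2 / n * t ^ 2 / 2)) := by
  obtain ⟨c, hc, hsub⟩ := exists_hasSubgaussianMGF_centeredRisk hn w h
  rw [← ofReal_integral_eq_lintegral_ofReal (hsub.integrable_exp_mul t)
    (ae_of_all _ fun s => (exp_pos _).le), ← hc]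
  exact ENNReal.ofReal_le_ofReal (hsub.mgf_le t)

/-- A bound that is uniform in `w`, from `|x| ≤ exp x + exp (-x)`. -/
lemma lintegral_enorm_centeredRisk_le (hn : 0 < n) (hℓ : Measurable (Function.uncurry ℓ))
    (w : Param d) (h : HasSubgaussianMGF (fun z => ℓ w z - ∫ z', ℓ w z' ∂D) (R ^ 2) D) :
    ∫⁻ s : Fin n → Z, ‖centeredRisk D ℓ w s‖ₑ ∂(Measure.pi fun _ => D)
      ≤ ENNReal.ofReal (exp ((R : ℝ) ^ 2 / n / 2))
        + ENNReal.ofReal (exp ((R : ℝ) ^ 2 / n / 2)) := by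
  have h1 := lintegral_exp_centeredRisk_le hn w h 1
  have h2 := lintegral_exp_centeredRisk_le hn w h (-1)
  have hm : Measurable fun s : Fin n → Z => centeredRisk D ℓ w s :=
    (measurable_centeredRisk hℓ).comp measurable_prodMk_left
  simp only [one_pow, mul_one, neg_sq] at h1 h2
  refine le_trans ?_ (add_le_add h1 h2)
  rw [← lintegral_add_left (by fun_prop)]
  refine lintegral_mono fun s => ?_
  rw [← ofReal_norm, ← ENNReal.ofReal_add (exp_pos _).le (exp_pos _).le]
  refine ENNReal.ofReal_le_ofReal ?_
  have e1 := add_one_le_exp (1 * centeredRisk D ℓ w s)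
  have e2 := add_one_le_exp (-1 * centeredRisk D ℓ w s)
  have e3 := exp_pos (1 * centeredRisk D ℓ w s)
  have e4 := exp_pos (-1 * centeredRisk D ℓ w s)
  rw [Real.norm_eq_abs]
  exact abs_le.2 ⟨by linarith, by linarith⟩

end Risk

section Transport

variable {Ω Z : Type*} {U m mΩ : MeasurableSpace Ω} [MeasurableSpace Z] {P : Measure Ω}
  [IsProbabilityMeasure P] {D : Measure Z} [IsProbabilityMeasure D] {d n N : ℕ}
  {ℓ : Param d → Z → ℝ} {R : ℝ≥0} {η : ℕ → ℝ} {J : ℕ → Ω → Multiset (Fin n)} {W₁ : Ω → Param d}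
  {S S' : Ω → Fin n → Z} {ε : ℕ → Ω → Param d} {Sg Sref : ℕ → Ω → Matrix (Fin d) (Fin d) ℝ}

/-- The entropy inequality applied to the centred risk of the virtual output. -/
lemma sq_integral_centeredRisk_virtualPath_le (hn : 0 < n) (hℓ : Measurable (Function.uncurry ℓ))
    (hdiff : ∀ z, Differentiable ℝ fun w => ℓ w z)
    (hsubG : ∀ w, HasSubgaussianMGF (fun z => ℓ w z - ∫ z', ℓ w z' ∂D) (R ^ 2) D)
    (hS : Measurable S) (hS_law : P.map S = Measure.pi fun _ => D) (hW₁ : Measurable W₁)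
    (hU : U ≤ mΩ) (hJ : ∀ k < N, Measurable[mΩ, ⊤] (J k))
    (h_indep : Indep (MeasurableSpace.comap W₁ inferInstance ⊔ U)
      (MeasurableSpace.comap S inferInstance) P)
    (hSg : IsPredictableCov P (history ℓ η J W₁ S) N Sg)
    (hε_meas : ∀ k < N, Measurable (ε k))
    (hε : IsVirtualNoise U P ℓ η J W₁ S N Sg ε)
    (hSref : ∀ k < N, IsAdmissibleRef P (refVisible U ℓ η J W₁ S ε k) (Sref k))
    (hpos : ∀ᵐ ω ∂P, 0 < ∏ j ∈ Finset.range N, stepRatio D ℓ η J W₁ S ε Sg Sref j ω)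
    (hlog : Integrable
      (fun ω => -log (∏ j ∈ Finset.range N, stepRatio D ℓ η J W₁ S ε Sg Sref j ω)) P) :
    Integrable (fun ω => centeredRisk D ℓ (virtualPath ℓ η J W₁ S ε N ω) (S ω)) P ∧
      (∫ ω, centeredRisk D ℓ (virtualPath ℓ η J W₁ S ε N ω) (S ω) ∂P) ^ 2
        ≤ 2 * ((R : ℝ) ^ 2 / n)
          * ∫ ω, -log (∏ j ∈ Finset.range N, stepRatio D ℓ η J W₁ S ε Sg Sref j ω) ∂P := by
  have hmle : noiseHistory U ℓ η J W₁ S N ε N ≤ mΩ :=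
    noiseHistory_le (history_le hℓ hdiff hS hW₁ hJ le_rfl) hS hU hε_meas le_rfl
  have hMm : Measurable fun ω => ∏ j ∈ Finset.range N, stepRatio D ℓ η J W₁ S ε Sg Sref j ω :=
    Finset.measurable_prod _ fun j hj => (measurable_stepRatio hℓ hdiff (Finset.mem_range.1 hj)
      hSg hSref).mono ((noiseHistory_mono (Finset.mem_range.1 hj)).trans hmle) le_rfl
  have hW : Measurable (virtualPath ℓ η J W₁ S ε N) :=
    (measurable_virtualPath_noiseHistory le_rfl).mono hmle le_rfl
  obtain ⟨hT, h1⟩ := tiltedIndep_prod_stepRatio hℓ hdiff hS hS_law hW₁ hU hJ h_indep hSg hε_meas hε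
    hSref N le_rfl
  refine sq_integral_le_of_lintegral_mul_exp_le hpos hMm
    ((measurable_centeredRisk hℓ).comp (hW.prodMk hS)) hlog fun t => ?_
  have hF : Measurable fun p : Param d × (Fin n → Z) =>
      ENNReal.ofReal (exp (t * centeredRisk D ℓ p.1 p.2)) := by
    have := measurable_centeredRisk (n := n) (D := D) hℓ
    fun_prop
  have := hT.lintegral_mul_le hS ((refVisible_le_noiseHistory le_rfl).trans hmle)
    hMm.ennreal_ofReal h1 (measurable_virtualPath_refVisible N) hF
    (fun w => lintegral_exp_centeredRisk_le hn w (hsubG w) t)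
  refine le_trans (le_of_eq (lintegral_congr fun ω => ?_)) this
  rw [ENNReal.ofReal_mul (Finset.prod_nonneg fun j _ => stepRatio_nonneg j ω)]
  rfl

/-- The accumulated noise as a disintegration over `m`. The accumulated covariance is
positive definite if there is at least one update and zero if there is none; `gaussKernel` covers
both cases. -/
lemma map_sum_noise (hℓ : Measurable (Function.uncurry ℓ))
    (hdiff : ∀ z, Differentiable ℝ fun w => ℓ w z) (hS : Measurable S) (hW₁ : Measurable W₁)
    (hU : U ≤ mΩ) (hJ : ∀ k < N, Measurable[mΩ, ⊤] (J k))
    (hSg : IsPredictableCov P (history ℓ η J W₁ S) N Sg)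
    (hε_meas : ∀ k < N, Measurable (ε k))
    (hε : IsVirtualNoise U P ℓ η J W₁ S N Sg ε) (hHm : history ℓ η J W₁ S N ≤ m)
    (hmle : m ≤ history ℓ η J W₁ S N ⊔ MeasurableSpace.comap S inferInstance) (hm : m ≤ mΩ)
    (hA : MatrixMeasurable m (accCov Sg N)) :
    (@Measure.map Ω (Ω × Param d) mΩ (m.prod inferInstance)
        (fun ω => (id ω, ∑ j ∈ Finset.range N, ε j ω)) P
      = (@Measure.map Ω Ω mΩ m id P) ⊗ₘ gaussKernel hA) ∧
    ∀ᵐ ω ∂P, gaussKernel hA ω = multivariateGaussian 0 (accCov Sg N ω) := by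
  have hκ : ∀ᵐ ω ∂P, gaussKernel hA ω = multivariateGaussian 0 (accCov Sg N ω) := by
    rcases Nat.eq_zero_or_pos N with rfl | hN
    · exact ae_of_all _ fun ω => gaussKernel_of_eq_zero hA (by simp [accCov])
    · exact (hSg.accCov_posDef hN).mono fun ω hω => gaussKernel_of_posDef hA hω
  refine ⟨?_, hκ⟩
  have hX : Measurable fun ω => ∑ j ∈ Finset.range N, ε j ω :=
    Finset.measurable_sum _ fun j hj => hε_meas j (Finset.mem_range.1 hj)
  have hYX : @Measurable Ω (Ω × Param d) mΩ (m.prod inferInstance)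
      (fun ω => (id ω, ∑ j ∈ Finset.range N, ε j ω)) := (measurable_id'' hm).prodMk hX
  refine @Measure.ext_of_lintegral _ (m.prod inferInstance) _ _ fun F hF => ?_
  rw [Measure.lintegral_compProd hF, ← trim_eq_map hm,
    lintegral_trim hm (Measurable.lintegral_kernel_prod_right' hF)]
  refine (@lintegral_map _ _ mΩ (m.prod inferInstance) P F _ hF hYX).trans ?_
  refine (lintegral_sum_noise hℓ hdiff hS hW₁ hU hJ hSg hε_meas hε hHm hmle le_rfl hF).trans ?_
  exact lintegral_congr_ae (hκ.mono fun ω hω => by simp only [hω])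

end Transport

section Transport

variable {Ω Z : Type*} {U m mΩ : MeasurableSpace Ω} [MeasurableSpace Z] {P : Measure Ω}
  [IsProbabilityMeasure P] {D : Measure Z} [IsProbabilityMeasure D] {d n N : ℕ}
  {ℓ : Param d → Z → ℝ} {R : ℝ≥0} {η : ℕ → ℝ} {J : ℕ → Ω → Multiset (Fin n)} {W₁ : Ω → Param d}
  {S S' : Ω → Fin n → Z} {ε : ℕ → Ω → Param d} {Sg : ℕ → Ω → Matrix (Fin d) (Fin d) ℝ}

/-- With a fresh Gaussian perturbation of the output, the ghost risk minus the sample risk averages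
to minus the centred sample risk of the virtual output. The sigma-field `m` is the one generated by
the final history and the sample; naming it keeps the two sigma-fields on `Ω` apart. -/
lemma integral_gaussian_empRisk_sub (hn : 0 < n) (hℓ : Measurable (Function.uncurry ℓ))
    (hdiff : ∀ z, Differentiable ℝ fun w => ℓ w z)
    (hsubG : ∀ w, HasSubgaussianMGF (fun z => ℓ w z - ∫ z', ℓ w z' ∂D) (R ^ 2) D)
    (hS : Measurable S) (hS' : Measurable S') (hS'_law : P.map S' = Measure.pi fun _ => D)
    (hW₁ : Measurable W₁)
    (hU : U ≤ mΩ) (hJ : ∀ k < N, Measurable[mΩ, ⊤] (J k))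
    (hHm : history ℓ η J W₁ S N ≤ m) (hSm : Measurable[m] S)
    (hmle : m ≤ history ℓ η J W₁ S N ⊔ MeasurableSpace.comap S inferInstance) (hm : m ≤ mΩ)
    (h_ghost : Indep (MeasurableSpace.comap S' inferInstance) m P)
    (hSg : IsPredictableCov P (history ℓ η J W₁ S) N Sg)
    (hε_meas : ∀ k < N, Measurable (ε k))
    (hε : IsVirtualNoise U P ℓ η J W₁ S N Sg ε)
    (hint : Integrable (fun ω => centeredRisk D ℓ (virtualPath ℓ η J W₁ S ε N ω) (S ω)) P) :
    ∫ ω, ∫ ζ, (empRisk ℓ (sgd ℓ η J W₁ S N ω + ζ) (S' ω)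
        - empRisk ℓ (sgd ℓ η J W₁ S N ω + ζ) (S ω)) ∂(multivariateGaussian 0 (accCov Sg N ω)) ∂P
      = -∫ ω, centeredRisk D ℓ (virtualPath ℓ η J W₁ S ε N ω) (S ω) ∂P := by
  have hA : MatrixMeasurable m (accCov Sg N) :=
    hSg.measurable_accCov fun k hk => (history_mono hk.le).trans hHm
  obtain ⟨hmap, hκ⟩ := map_sum_noise hℓ hdiff hS hW₁ hU hJ hSg hε_meas hε hHm hmle hm hA
  have hX : @Measurable _ _ mΩ _ fun ω => ∑ j ∈ Finset.range N, ε j ω :=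
    Finset.measurable_sum _ fun j hj => hε_meas j (Finset.mem_range.1 hj)
  have hYS' := map_prodMk_eq_prod_of_indep (mα := m) (mΩ := mΩ) (P := P) (Y := id)
    (measurable_id'' hm) hS' (by rw [MeasurableSpace.comap_id]; exact h_ghost)
  rw [hS'_law] at hYS'
  have hWm : Measurable[m] (sgd ℓ η J W₁ S N) :=
    (measurable_sgd_history le_rfl).mono hHm le_rfl
  simp only [virtualPath_eq] at hint ⊢
  have hH : @Measurable ((Ω × Param d) × (Fin n → Z)) ℝ
      (@Prod.instMeasurableSpace _ _ (m.prod inferInstance) inferInstance) _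
      fun p => centeredRisk D ℓ (sgd ℓ η J W₁ S N p.1.1 + p.1.2) p.2 :=
    (measurable_centeredRisk hℓ).comp ((((hWm.comp measurable_fst).add measurable_snd).comp
      measurable_fst).prodMk measurable_snd)
  have h := integral_kernel_ghost_sub (mα := m) (mΩ := mΩ) (P := P) (Y := id)
    (measurable_id'' hm) hX hmap hS' hYS' hSm hH hint
    (ENNReal.add_ne_top.2 ⟨ENNReal.ofReal_ne_top, ENNReal.ofReal_ne_top⟩)
    (fun p => lintegral_enorm_centeredRisk_le hn hℓ (sgd ℓ η J W₁ S N p.1 + p.2) (hsubG _))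
    (fun p => integral_centeredRisk hn (sgd ℓ η J W₁ S N p.1 + p.2) (hsubG _))
  refine Eq.trans (integral_congr_ae ?_) h
  filter_upwards [hκ] with ω hω
  -- the population risks of the two centred risks cancel
  simp only [id, hω, centeredRisk, sub_sub_sub_cancel_right]

end Transport

/-- Replacing the output by its Gaussian smoothing changes the generalization gap by the difference
of the output sensitivities. -/
lemma genError_sub_integral_outputSensitivity_sub {Ω Z : Type*} {mΩ : MeasurableSpace Ω}
    {P : Measure Ω} {d n : ℕ} {ℓ : Param d → Z → ℝ} {S S' : Ω → Fin n → Z} {W : Ω → Param d}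
    {C : Ω → Matrix (Fin d) (Fin d) ℝ}
    (hgen : Integrable (fun ω => empRisk ℓ (W ω) (S' ω) - empRisk ℓ (W ω) (S ω)) P)
    (hΔ : ∀ᵐ ω ∂P, Integrable (fun ζ => empRisk ℓ (W ω + ζ) (S ω)) (multivariateGaussian 0 (C ω)))
    (hΔ' : ∀ᵐ ω ∂P,
      Integrable (fun ζ => empRisk ℓ (W ω + ζ) (S' ω)) (multivariateGaussian 0 (C ω)))
    (hΔd : Integrable (fun ω => outputSensitivity ℓ (C ω) (W ω) (S' ω)
      - outputSensitivity ℓ (C ω) (W ω) (S ω)) P) :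
    genError P ℓ W S S' - ∫ ω, (outputSensitivity ℓ (C ω) (W ω) (S' ω)
        - outputSensitivity ℓ (C ω) (W ω) (S ω)) ∂P
      = ∫ ω, ∫ ζ, (empRisk ℓ (W ω + ζ) (S' ω) - empRisk ℓ (W ω + ζ) (S ω))
          ∂(multivariateGaussian 0 (C ω)) ∂P := by
  rw [genError, ← integral_sub hgen hΔd]
  refine integral_congr_ae ?_
  filter_upwards [hΔ, hΔ'] with ω h h'
  rw [outputSensitivity, outputSensitivity, integral_sub (integrable_const _) h',
    integral_sub (integrable_const _) h, integral_sub h' h]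
  simp
  ring

end VirtualSGD

end

theorem mainTheorem3
    {Ω Z : Type*} (U : MeasurableSpace Ω) [mΩ : MeasurableSpace Ω] [MeasurableSpace Z]
    (P : Measure Ω) [IsProbabilityMeasure P] (D : Measure Z) [IsProbabilityMeasure D]
    {d n : ℕ} (hn : 0 < n) (N : ℕ)
    -- loss
    (ℓ : VirtualSGD.Param d → Z → ℝ) (R : ℝ≥0)
    (hℓ_meas : Measurable (Function.uncurry ℓ))
    (hℓ_diff : ∀ z, Differentiable ℝ fun w => ℓ w z)
    (hℓ_grad : ∀ w, Integrable (VirtualSGD.sampleGrad ℓ w) D)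
    (hℓ_subG : ∀ w, HasSubgaussianMGF (fun z => ℓ w z - ∫ z', ℓ w z' ∂D) (R ^ 2) D)
    -- sample, ghost sample, initialization, auxiliary randomness, learning rates, minibatches
    (S S' : Ω → Fin n → Z) (W₁ : Ω → VirtualSGD.Param d)
    (η : ℕ → ℝ) (J : ℕ → Ω → Multiset (Fin n))
    (hS : Measurable S) (hS_law : P.map S = Measure.pi fun _ => D)
    (hS' : Measurable S') (hS'_law : P.map S' = Measure.pi fun _ => D)
    (hW₁ : Measurable W₁) (hU : U ≤ mΩ)
    (hη : ∀ k < N, 0 < η k)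
    (hJ_meas : ∀ k < N, Measurable[mΩ, ⊤] (J k))
    (hJ_ne : ∀ k < N, ∀ᵐ ω ∂P, J k ω ≠ 0)
    (h_indep : Indep (MeasurableSpace.comap W₁ inferInstance ⊔ U)
      (MeasurableSpace.comap S inferInstance) P)
    (h_ghost : Indep (MeasurableSpace.comap S' inferInstance)
      (VirtualSGD.history ℓ η J W₁ S N ⊔ MeasurableSpace.comap S inferInstance) P)
    -- actual covariances, virtual perturbations, reference covariances
    (Sg Sref : ℕ → Ω → Matrix (Fin d) (Fin d) ℝ) (ε : ℕ → Ω → VirtualSGD.Param d)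
    (hSg : VirtualSGD.IsPredictableCov P (VirtualSGD.history ℓ η J W₁ S) N Sg)
    (hε_meas : ∀ k < N, Measurable (ε k))
    (hε : VirtualSGD.IsVirtualNoise U P ℓ η J W₁ S N Sg ε)
    (hSref : ∀ k < N,
      VirtualSGD.IsAdmissibleRef P (VirtualSGD.refVisible U ℓ η J W₁ S ε k) (Sref k))
    -- finiteness of the quantities in the bound
    (hV_fin : ∀ k < N, Integrable (fun ω => VirtualSGD.sqNorm (Sg k ω)⁻¹
      (VirtualSGD.stochGrad ℓ η J W₁ S k ω
        - VirtualSGD.popGrad D ℓ (VirtualSGD.sgd ℓ η J W₁ S k ω))) P)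
    (hΓ_fin : ∀ k < N, Integrable (fun ω => VirtualSGD.sqNorm (Sg k ω)⁻¹
      (VirtualSGD.popGrad D ℓ (VirtualSGD.sgd ℓ η J W₁ S k ω
          + VirtualSGD.accNoise ℓ η J W₁ S ε k ω)
        - VirtualSGD.popGrad D ℓ (VirtualSGD.sgd ℓ η J W₁ S k ω))) P)
    (hC_fin : ∀ k < N, Integrable (fun ω => VirtualSGD.covMismatch (Sg k ω) (Sref k ω)) P)
    (hgen_fin : Integrable (fun ω =>
      VirtualSGD.empRisk ℓ (VirtualSGD.sgd ℓ η J W₁ S N ω) (S' ω)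
        - VirtualSGD.empRisk ℓ (VirtualSGD.sgd ℓ η J W₁ S N ω) (S ω)) P)
    (hΔ_fin : ∀ᵐ ω ∂P, Integrable (fun ζ =>
      VirtualSGD.empRisk ℓ (VirtualSGD.sgd ℓ η J W₁ S N ω + ζ) (S ω))
        (multivariateGaussian 0 (VirtualSGD.accCov Sg N ω)))
    (hΔ'_fin : ∀ᵐ ω ∂P, Integrable (fun ζ =>
      VirtualSGD.empRisk ℓ (VirtualSGD.sgd ℓ η J W₁ S N ω + ζ) (S' ω))
        (multivariateGaussian 0 (VirtualSGD.accCov Sg N ω)))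
    (hΔ_diff_fin : Integrable (fun ω =>
      VirtualSGD.outputSensitivity ℓ (VirtualSGD.accCov Sg N ω)
          (VirtualSGD.sgd ℓ η J W₁ S N ω) (S' ω)
        - VirtualSGD.outputSensitivity ℓ (VirtualSGD.accCov Sg N ω)
          (VirtualSGD.sgd ℓ η J W₁ S N ω) (S ω)) P)
    -- comparable geometries
    (κ : ℝ) (hκ : 1 ≤ κ)
    (h_comp : ∀ k < N, ∀ᵐ ω ∂P, (κ • (Sg k ω)⁻¹ - (Sref k ω)⁻¹).PosSemidef) :
    |VirtualSGD.genError P ℓ (VirtualSGD.sgd ℓ η J W₁ S N) S S'| ≤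
      √((2 * (R : ℝ) ^ 2 / n) *
          (2 * κ * ∑ k ∈ Finset.range N, η k ^ 2 *
              ∫ ω, (VirtualSGD.gradDeviation U P D ℓ η J W₁ S (fun ω => (Sg k ω)⁻¹) k ω
                + VirtualSGD.gradSensitivity U P D ℓ η J W₁ S ε (fun ω => (Sg k ω)⁻¹) k ω) ∂P
            + ∑ k ∈ Finset.range N, VirtualSGD.covCost P (Sg k) (Sref k)))
        + VirtualSGD.outputPenalty P ℓ (VirtualSGD.accCov Sg N)
            (VirtualSGD.sgd ℓ η J W₁ S N) S S' := by
  have hκ0 : 0 ≤ κ := zero_le_one.trans hκ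
  obtain ⟨hpos, hlog, hcost⟩ := VirtualSGD.integral_neg_log_prod_stepRatio_le hℓ_meas hℓ_diff hS hW₁
    hU hJ_meas hSg hε_meas hε hSref hV_fin hΓ_fin hC_fin hκ0 h_comp
  obtain ⟨hint, hsq⟩ := VirtualSGD.sq_integral_centeredRisk_virtualPath_le hn hℓ_meas hℓ_diff
    hℓ_subG hS hS_law hW₁ hU hJ_meas h_indep hSg hε_meas hε hSref hpos hlog
  have hfresh := VirtualSGD.integral_gaussian_empRisk_sub hn hℓ_meas hℓ_diff hℓ_subG hS hS' hS'_law
    hW₁ hU hJ_meas le_sup_left ((comap_measurable S).mono le_sup_right le_rfl) le_rfl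
    (sup_le (VirtualSGD.history_le hℓ_meas hℓ_diff hS hW₁ hJ_meas le_rfl) hS.comap_le) h_ghost
    hSg hε_meas hε hint
  have hgen := VirtualSGD.genError_sub_integral_outputSensitivity_sub hgen_fin hΔ_fin hΔ'_fin
    hΔ_diff_fin
  rw [hfresh] at hgen
  rw [sub_eq_iff_eq_add] at hgen
  rw [hgen, VirtualSGD.outputPenalty]
  refine (abs_add_le _ _).trans (add_le_add ?_ le_rfl)
  rw [abs_neg]
  refine Real.abs_le_sqrt (hsq.trans ?_)
  rw [← mul_div_assoc]
  exact mul_le_mul_of_nonneg_left hcost (by positivity)
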